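/- \textbf{Setting.} Consider an episodic MDP with finite state space $\mathcal S$, action space $\mathcal A$, horizon $H$, and multinomial logit transitions: at step $h\in[H]$, with reachable set $\emptyset\neq\mathcal S_h(s,a)\subseteq\mathcal S$ and rows $\varphi(s,a,s')=\Phi(s,a)^\top e_{s'}\in\mathbb R^d$ of the feature matrix ($d\ge 1$), $$\mathbb P_h(s'\mid s,a,\theta)=\frac{\exp(\varphi(s,a,s')^\top\theta)}{\sum_{\bar s\in\mathcal S_h(s,a)}\exp(\varphi(s,a,\bar s)^\top\theta)}\quad(s'\in\mathcal S_h(s,a)),$$ the true parameter at step $h$ being $\theta_h^\star$. Assume $\|\varphi(s,a,s')\|_2\le B_\Phi$ for all $s,a,s'$ and $\|\theta^\star_h\|_2\le B_\theta$ for all $h$. Let $s_{k,h},a_{k,h}$ ($k\in[K]$) be the states and actions of $K$ episodes of interaction: initial states and actions are chosen arbitrarily (possibly randomized and depending on the past), and conditionally on all states and actions of the previous episodes and on those of episode $k$ up to step $h$, the next state $s_{k,h+1}$ has law $\mathbb P_h(\cdot\mid s_{k,h},a_{k,h},\theta_h^\star)$. Fix $h\in[H]$, $\epsilon>0$, $\delta\in(0,1)$,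 let $\ell_{k,h}(\theta)=-\log\mathbb P_h(s_{k,h+1}\mid s_{k,h},a_{k,h},\theta)$ and let $\eta=(e-1)(3+4B_\Phi^2B_\theta^2)$. Put $\|x\|_Q=\sqrt{x^\top Qx}$. The (projected) Online Newton Step iterates are $\theta_{0,h}=0$ and, for $k\ge1$, $$g_{k,h}=\nabla\ell_{k,h}(\theta_{k-1,h}),\qquad \widehat H_{k,h}=\sum_{\nu=1}^k g_{\nu,h}g_{\nu,h}^\top+\epsilon I_d,$$ $$\theta_{k,h}=\operatorname*{argmin}_{\|\theta\|_2\le B_\theta}\big\|\theta-\big(\theta_{k-1,h}-\eta\widehat H_{k,h}^{-1}g_{k,h}\big)\big\|^2_{\widehat H_{k,h}},$$ and the estimator is $\widehat\theta_{k,h}=\widehat H_{k,h}^{-1}\sum_{\nu=1}^k g_{\nu,h}g_{\nu,h}^\top\theta_{\nu-1,h}$. \textbf{Theorem.} There are an absolute constant $C>0$ and numbers $\gamma_k=\gamma_k(d,B_\Phi,B_\theta,\epsilon,\delta)\ge 0$, depending only on the displayed parameters and on $k$, such that in every such setting, for every $h\in[H]$, with probability at least $1-3\delta$, $$\|\widehat\theta_{k,h}-\theta^\star_h\|_{\widehat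 H_{k,h}}\le\beta_k:=\sqrt\epsilon\,B_\theta+\sqrt{\epsilon B_\theta^2+4\gamma_k}\qquad\text{for all }k\in[K],$$ and $\gamma_k=\tilde O(dB_\Phi^4B_\theta^4)$ in the following sense: for all $d,k\ge1$, $B_\Phi,B_\theta\ge0$, $\epsilon>0$, $\delta\in(0,1)$, $$\gamma_k\le C\Big(\epsilon B_\theta^2+d\,\max(1,B_\Phi B_\theta)^4\big(1+\log\tfrac{dk}{\delta}+\log(1+B_\Phi^2/\epsilon)\big)\Big),$$ and in particular, if $B_\Phi B_\theta\ge1$ and $\epsilon=B_\Phi^2(1+4\log(d/\delta))$, then $\gamma_k\le C\,d\,B_\Phi^4B_\theta^4\,\big(1+\log\frac{dk}{\delta}\big)$. -/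

import Mathlib

open MeasureTheory

/-- The transition part of an episodic multinomial logit MDP with state space `S` (finite), action
space `A`, horizon `H` and parameter dimension `d`.  The steps `1, …, H` of an episode are the
elements of `Fin H`. -/
structure MNLModel (S A : Type*) [MeasurableSpace A] (d H : ℕ) where
  /-- the set of states that are reachable from `s` with action `a` at step `h` -/
  reach : Fin H → S → A → Finset S
  reach_nonempty : ∀ h s a, (reach h s a).Nonempty
  /-- `feature s a s'` is the row of the feature matrix of `(s, a)` that belongs to `s'` -/
  feature : S → A → S → EuclideanSpace ℝ (Fin d)
  /-- the unknown transition parameter of step `h` -/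
  θstar : Fin H → EuclideanSpace ℝ (Fin d)
  measurableSet_reach : ∀ h s s', MeasurableSet {a | s' ∈ reach h s a}
  measurable_feature : ∀ s s', Measurable fun a => feature s a s'

namespace MNLModel

variable {S A : Type*} [MeasurableSpace A] {d H : ℕ}

open Classical in
/-- The multinomial logit transition probability of `s'` at step `h` from `(s, a)`
under the parameter `θ`. -/
noncomputable def transProb (M : MNLModel S A d H) (h : Fin H) (s : S) (a : A)
    (θ : EuclideanSpace ℝ (Fin d)) (s' : S) : ℝ :=
  if s' ∈ M.reach h s a then
    Real.exp (inner ℝ (M.feature s a s') θ) /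
      ∑ t ∈ M.reach h s a, Real.exp (inner ℝ (M.feature s a t) θ)
  else 0

/-- The negative log-likelihood of the transition `(s, a) → s'` at step `h`, as a function of the
parameter. -/
noncomputable def nll (M : MNLModel S A d H) (h : Fin H) (s : S) (a : A) (s' : S)
    (θ : EuclideanSpace ℝ (Fin d)) : ℝ :=
  -inner ℝ (M.feature s a s') θ +
    Real.log (∑ t ∈ M.reach h s a, Real.exp (inner ℝ (M.feature s a t) θ))

end MNLModel

section Interaction

variable {S A Ω : Type*} [MeasurableSpace S] [MeasurableSpace A] {d H : ℕ}

/-- The sigma-algebra of everything observed before the transition at step `h` of episode `k`: all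
states and actions of the episodes `1, …, k - 1`, and the states and actions of episode `k` up to
step `h`.  The states of an episode carry the indices `0, …, H`, the state at step `h` being
`s k h.castSucc` and the next one `s k h.succ`. -/
abbrev history (s : ℕ → Fin (H + 1) → Ω → S) (a : ℕ → Fin H → Ω → A) (k : ℕ) (h : Fin H) :
    MeasurableSpace Ω :=
  (⨆ (j : ℕ) (_ : 1 ≤ j ∧ j < k) (i : Fin (H + 1)), MeasurableSpace.comap (s j i) inferInstance) ⊔
  (⨆ (j : ℕ) (_ : 1 ≤ j ∧ j < k) (i : Fin H), MeasurableSpace.comap (a j i) inferInstance) ⊔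
  (⨆ (i : Fin (H + 1)) (_ : i ≤ h.castSucc), MeasurableSpace.comap (s k i) inferInstance) ⊔
  (⨆ (i : Fin H) (_ : i ≤ h), MeasurableSpace.comap (a k i) inferInstance)

/-- `s` and `a` are the states and actions of `K` episodes of interaction with the MDP: the initial
states and the actions are chosen in an arbitrary (possibly randomized and history dependent) way,
and given the past, every next state follows the transition kernel of the true parameter. -/
structure IsInteraction [MeasurableSpace Ω] (M : MNLModel S A d H) (μ : Measure Ω) (K : ℕ)
    (s : ℕ → Fin (H + 1) → Ω → S) (a : ℕ → Fin H → Ω → A) : Prop where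
  measurable_state : ∀ k ∈ Finset.Icc 1 K, ∀ i, Measurable (s k i)
  measurable_action : ∀ k ∈ Finset.Icc 1 K, ∀ i, Measurable (a k i)
  transition : ∀ k ∈ Finset.Icc 1 K, ∀ (h : Fin H) (s' : S),
    μ[(s k h.succ ⁻¹' {s'}).indicator (fun _ => (1 : ℝ)) | history s a k h]
      =ᵐ[μ] fun ω => M.transProb h (s k h.castSucc ω) (a k h ω) (M.θstar h) s'

/-- The loss of episode `k` at step `h` along the realized trajectory `ω`. -/
noncomputable def realizedLoss (M : MNLModel S A d H) (s : ℕ → Fin (H + 1) → Ω → S)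
    (a : ℕ → Fin H → Ω → A) (h : Fin H) (ω : Ω) (k : ℕ) : EuclideanSpace ℝ (Fin d) → ℝ :=
  M.nll h (s k h.castSucc ω) (a k h ω) (s k h.succ ω)

end Interaction

section Newton

variable {d : ℕ}

/-- The norm `‖x‖_Q = √(xᵀ Q x)`. -/
noncomputable def matNorm (Q : Matrix (Fin d) (Fin d) ℝ) (x : EuclideanSpace ℝ (Fin d)) : ℝ :=
  Real.sqrt (x.ofLp ⬝ᵥ Q.mulVec x.ofLp)

/-- The rank-one matrix `g gᵀ`. -/
def outer (g : EuclideanSpace ℝ (Fin d)) : Matrix (Fin d) (Fin d) ℝ :=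
  Matrix.vecMulVec g.ofLp g.ofLp

/-- The matrix-vector product as a vector of the Euclidean space. -/
noncomputable def matApply (Q : Matrix (Fin d) (Fin d) ℝ) (x : EuclideanSpace ℝ (Fin d)) :
    EuclideanSpace ℝ (Fin d) :=
  WithLp.toLp 2 (Q.mulVec x.ofLp)

/-- The projection of `x` onto the Euclidean ball of radius `B` in the norm `‖·‖_Q`, i.e. the
minimizer of `‖y - x‖_Q²` over the `y` with `‖y‖₂ ≤ B`. -/
noncomputable def ballProj (B : ℝ) (Q : Matrix (Fin d) (Fin d) ℝ) (x : EuclideanSpace ℝ (Fin d)) :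
    EuclideanSpace ℝ (Fin d) :=
  Classical.epsilon fun y => y ∈ Metric.closedBall 0 B ∧
    IsMinOn (fun z => matNorm Q (z - x) ^ 2) (Metric.closedBall 0 B) y

/-- The state (iterate, matrix) of the projected Online Newton Step after `k` rounds with the losses
`ℓ 1, …, ℓ k`, initial matrix `ε I`, learning rate `η` and radius `B`. -/
noncomputable def onsState (ℓ : ℕ → EuclideanSpace ℝ (Fin d) → ℝ) (ε η B : ℝ) :
    ℕ → EuclideanSpace ℝ (Fin d) × Matrix (Fin d) (Fin d) ℝ
  | 0 => (0, ε • 1)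
  | k + 1 =>
    let θ := (onsState ℓ ε η B k).1
    let g := gradient (ℓ (k + 1)) θ
    let Q := (onsState ℓ ε η B k).2 + outer g
    (ballProj B Q (θ - η • matApply Q⁻¹ g), Q)

/-- The Online Newton Step iterate `θ_k`. -/
noncomputable def onsIterate (ℓ : ℕ → EuclideanSpace ℝ (Fin d) → ℝ) (ε η B : ℝ) (k : ℕ) :
    EuclideanSpace ℝ (Fin d) :=
  (onsState ℓ ε η B k).1

/-- The gradient `g_ν = ∇ℓ_ν(θ_{ν-1})`, for `ν ≥ 1`. -/
noncomputable def onsGrad (ℓ : ℕ → EuclideanSpace ℝ (Fin d) → ℝ) (ε η B : ℝ) (ν : ℕ) :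
    EuclideanSpace ℝ (Fin d) :=
  gradient (ℓ ν) (onsIterate ℓ ε η B (ν - 1))

/-- The observed information matrix `∑_{ν ≤ k} g_ν g_νᵀ + ε I`. -/
noncomputable def obsInfo (ℓ : ℕ → EuclideanSpace ℝ (Fin d) → ℝ) (ε η B : ℝ) (k : ℕ) :
    Matrix (Fin d) (Fin d) ℝ :=
  ∑ ν ∈ Finset.Icc 1 k, outer (onsGrad ℓ ε η B ν) + ε • 1

/-- The matrix kept by the algorithm is the observed information matrix. -/
theorem onsState_snd (ℓ : ℕ → EuclideanSpace ℝ (Fin d) → ℝ) (ε η B : ℝ) (k : ℕ) :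
    (onsState ℓ ε η B k).2 = obsInfo ℓ ε η B k := by
  induction k with
  | zero => simp [onsState, obsInfo]
  | succ k ih =>
    rw [obsInfo, Finset.sum_Icc_succ_top (by omega), add_right_comm]
    change (onsState ℓ ε η B k).2 + _ = _
    rw [ih]
    rfl

/-- The estimator `Ĥ_k⁻¹ ∑_{ν ≤ k} g_ν g_νᵀ θ_{ν-1}`. -/
noncomputable def estimator (ℓ : ℕ → EuclideanSpace ℝ (Fin d) → ℝ) (ε η B : ℝ) (k : ℕ) :
    EuclideanSpace ℝ (Fin d) :=
  matApply (obsInfo ℓ ε η B k)⁻¹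
    (∑ ν ∈ Finset.Icc 1 k, matApply (outer (onsGrad ℓ ε η B ν)) (onsIterate ℓ ε η B (ν - 1)))

/-- The learning rate `(e - 1)(3 + 4 B_Φ² B_θ²)`. -/
noncomputable def learningRate (BΦ Bθ : ℝ) : ℝ :=
  (Real.exp 1 - 1) * (3 + 4 * BΦ ^ 2 * Bθ ^ 2)

end Newton

/-! Write x_ν = ⟨g_ν, θ_{ν-1} - θ*⟩, b = B_Φ B_θ and m = max(1, b). The estimator solves a ridge
normal equation with responses ⟨g_ν, θ_{ν-1}⟩, so its error is at most √ε B_θ + √(∑ x_ν²)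
(`matNorm_estimator_sub_le`), and everything reduces to bounding ∑ x_ν².

Two opposite inequalities do this. Deterministically, the Newton step satisfies ∑ (2η x_ν - x_ν²) ≤
ε B_θ² + η² d log(d + 4k B_Φ²/ε) (`ons_regret`). With probability at least 1 - δ, ∑ (2η x_ν - (3/2)
x_ν²) ≥ -1000 m⁴ log(1/δ) simultaneously for all k (`linRegret_concentration`). Their difference
leaves ½ ∑ x_ν² on the small side (`sum_sq_le_confRadius`).

The second inequality uses the logit structure and no curvature lower bound, which would be
exponentially small in b. If p is the true transition law, that of θ_{ν-1} is the tilting q ∝ p e^Z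
with Z = ⟨φ, θ_{ν-1} - θ*⟩, and x_ν = E_q Z - Z. By `sum_tilt_sq_le`, E_p x² ≤ (1 + 8b) E_p x, so a
learning rate polynomial in b makes the linear term dominate the quadratic one.
`sum_tilt_exp_le_one` turns this into an exponential moment bound at scale 1/(1000 m⁴), and
`ville_prod` makes it uniform in k. -/

/-! ### Moments under exponential tilting, and the size of the learning rate. -/

theorem sq_div_one_add_le_mul_exp_sub_one {x D : ℝ} (hx : |x| ≤ D) :
    x ^ 2 ≤ (1 + D) * (x * (Real.exp x - 1)) := by
  obtain ⟨h1, h2⟩ := abs_le.mp hx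
  have hD : 0 ≤ D := (abs_nonneg x).trans hx
  rcases le_total 0 x with h | h
  · have h3 : x ≤ Real.exp x - 1 := by linarith [Real.add_one_le_exp x]
    have h4 : x ^ 2 ≤ x * (Real.exp x - 1) := by nlinarith
    nlinarith [mul_nonneg hD (mul_nonneg h (h.trans h3))]
  -- Only negative x costs the factor 1 + D: there 1 - e^x ≥ -x / (1 - x), and 1 - x ≤ 1 + D.
  · have h3 : 1 - x ≤ Real.exp (-x) := by linarith [Real.add_one_le_exp (-x)]
    have h4 : Real.exp x * (1 - x) ≤ 1 := by
      calc Real.exp x * (1 - x) ≤ Real.exp x * Real.exp (-x) := by gcongr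
        _ = 1 := by rw [← Real.exp_add]; simp
    have h6 : 0 ≤ 1 - Real.exp x := by linarith [Real.exp_le_one_iff.mpr h]
    have h5 : -x ≤ (1 + D) * (1 - Real.exp x) := by nlinarith
    nlinarith [mul_le_mul_of_nonneg_left h5 (neg_nonneg.mpr h)]

/-- Under exponential tilting `q ∝ p e^Z` of a finite distribution with `|Z| ≤ R`, the second moment
under `p` of `E_q Z - Z` is bounded by its first moment. -/
theorem sum_tilt_sq_le {ι : Type*} (T : Finset ι) (p Z : ι → ℝ) {R : ℝ}
    (hp : ∀ i ∈ T, 0 ≤ p i) (hsum : ∑ i ∈ T, p i = 1) (hZ : ∀ i ∈ T, |Z i| ≤ R) {e : ℝ}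
    (he : e = (∑ i ∈ T, p i * Real.exp (Z i) * Z i) / ∑ i ∈ T, p i * Real.exp (Z i)) :
    ∑ i ∈ T, p i * (e - Z i) ^ 2 ≤ (1 + 4 * R) * ∑ i ∈ T, p i * (e - Z i) := by
  set N := ∑ i ∈ T, p i * Real.exp (Z i) with hN
  have hN1 : Real.exp (-R) ≤ N := by
    calc Real.exp (-R) = ∑ i ∈ T, p i * Real.exp (-R) := by rw [← Finset.sum_mul, hsum, one_mul]
      _ ≤ N := Finset.sum_le_sum fun i hi => by
        gcongr
        · exact hp i hi
        · exact (abs_le.mp (hZ i hi)).1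
  have hN2 : N ≤ Real.exp R := by
    calc N ≤ ∑ i ∈ T, p i * Real.exp R := Finset.sum_le_sum fun i hi => by
          gcongr
          · exact hp i hi
          · exact (abs_le.mp (hZ i hi)).2
      _ = Real.exp R := by rw [← Finset.sum_mul, hsum, one_mul]
  have hN0 : 0 < N := (Real.exp_pos _).trans_le hN1
  -- Centering at the log-normalizer makes e^(Z - c) the density of q with respect to p. Hence
  -- E_p[(Z - c)(e^(Z - c) - 1)] = E_q Z - E_p Z, and the scalar inequality applies with D = 2R.
  set c := Real.log N with hc
  have hc1 : -R ≤ c := by rw [hc, Real.le_log_iff_exp_le hN0]; exact hN1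
  have hc2 : c ≤ R := by rw [hc, Real.log_le_iff_le_exp hN0]; exact hN2
  have hU : ∀ i ∈ T, |Z i - c| ≤ 2 * R := fun i hi => by
    obtain ⟨h1, h2⟩ := abs_le.mp (hZ i hi)
    rw [abs_le]; constructor <;> linarith
  have hexp : ∀ i, Real.exp (Z i - c) = Real.exp (Z i) / N := fun i => by
    rw [Real.exp_sub, hc, Real.exp_log hN0]
  set A1 := ∑ i ∈ T, p i * Z i with hA1
  set A2 := ∑ i ∈ T, p i * Z i ^ 2 with hA2
  have hm : ∑ i ∈ T, p i * (e - Z i) = e - A1 := by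
    simp only [mul_sub, Finset.sum_sub_distrib, ← Finset.sum_mul, hsum, one_mul, hA1]
  have hV : ∑ i ∈ T, p i * (e - Z i) ^ 2 = e ^ 2 - 2 * e * A1 + A2 := by
    have : ∀ i, p i * (e - Z i) ^ 2 = p i * e ^ 2 - 2 * e * (p i * Z i) + p i * Z i ^ 2 :=
      fun i => by ring
    simp only [this, Finset.sum_add_distrib, Finset.sum_sub_distrib, ← Finset.sum_mul,
      ← Finset.mul_sum, hsum, one_mul, hA1, hA2]
  have hW : ∑ i ∈ T, p i * (Z i - c) ^ 2 = A2 - 2 * c * A1 + c ^ 2 := by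
    have : ∀ i, p i * (Z i - c) ^ 2 = p i * Z i ^ 2 - 2 * c * (p i * Z i) + p i * c ^ 2 :=
      fun i => by ring
    simp only [this, Finset.sum_add_distrib, Finset.sum_sub_distrib, ← Finset.sum_mul,
      ← Finset.mul_sum, hsum, one_mul, hA1, hA2]
  have hm' : ∑ i ∈ T, p i * ((Z i - c) * (Real.exp (Z i - c) - 1)) = e - A1 := by
    have : ∀ i, p i * ((Z i - c) * (Real.exp (Z i - c) - 1)) =
        (p i * Real.exp (Z i) * Z i) / N - c * ((p i * Real.exp (Z i)) / N) - p i * Z i + c * p i :=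
      fun i => by rw [hexp]; ring
    simp only [this, Finset.sum_add_distrib, Finset.sum_sub_distrib,
      ← Finset.mul_sum, ← Finset.sum_div, hsum, ← hN, ← he, div_self hN0.ne', ← hA1]
    ring
  have key : A2 - 2 * c * A1 + c ^ 2 ≤ (1 + 2 * R) * (e - A1) := by
    rw [← hW, ← hm', Finset.mul_sum]
    refine Finset.sum_le_sum fun i hi => ?_
    have := mul_le_mul_of_nonneg_left (sq_div_one_add_le_mul_exp_sub_one (hU i hi)) (hp i hi)
    linarith
  have hR : 0 ≤ R := by linarith
  have hm0 : 0 ≤ e - A1 := by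
    have : 0 ≤ ∑ i ∈ T, p i * (Z i - c) ^ 2 :=
      Finset.sum_nonneg fun i hi => mul_nonneg (hp i hi) (sq_nonneg _)
    rw [hW] at this
    exact nonneg_of_mul_nonneg_right (this.trans key) (by positivity)
  have hA1R : -R ≤ A1 := by
    calc -R = ∑ i ∈ T, p i * (-R) := by rw [← Finset.sum_mul, hsum, one_mul]
      _ ≤ A1 := Finset.sum_le_sum fun i hi =>
        mul_le_mul_of_nonneg_left (abs_le.mp (hZ i hi)).1 (hp i hi)
  have heR : e ≤ R := by
    rw [he, div_le_iff₀ hN0, hN, Finset.mul_sum]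
    refine Finset.sum_le_sum fun i hi => ?_
    have := mul_le_mul_of_nonneg_left (abs_le.mp (hZ i hi)).2
      (mul_nonneg (hp i hi) (Real.exp_pos (Z i)).le)
    linarith
  rw [hV, hm]
  -- E_p(e - Z)² is the variance plus (e - A1)². The variance is at most E_p(Z - c)² ≤ (1 + 2R)(e -
  -- A1), and e - A1 ≤ 2R bounds the square by 2R(e - A1).
  nlinarith [sq_nonneg (A1 - c)]

/-- The exponential moment bound for `2 η x - (3 / 2) x²`, where `x = E_q Z - Z` for the exponential
tilting `q ∝ p e^Z`. -/
theorem sum_tilt_exp_le_one {ι : Type*} (T : Finset ι) (p Z : ι → ℝ) {b η m : ℝ}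
    (hp : ∀ i ∈ T, 0 ≤ p i) (hsum : ∑ i ∈ T, p i = 1) (hZ : ∀ i ∈ T, |Z i| ≤ 2 * b) {e : ℝ}
    (he : e = (∑ i ∈ T, p i * Real.exp (Z i) * Z i) / ∑ i ∈ T, p i * Real.exp (Z i))
    (hx : ∀ i ∈ T, |e - Z i| ≤ 4 * b) (hη1 : 2.461 * (1 + 8 * b) ≤ 2 * η) (hm1 : 1 ≤ m)
    (hbm : b ≤ m) (hη2 : η ≤ 12.5 * m ^ 2) :
    ∑ i ∈ T, p i * Real.exp (-(1 / (1000 * m ^ 4)) *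
      (2 * η * (e - Z i) - 3 / 2 * (e - Z i) ^ 2)) ≤ 1 := by
  have hVm := sum_tilt_sq_le T p Z hp hsum hZ he
  set V := ∑ i ∈ T, p i * (e - Z i) ^ 2 with hV
  set μ := ∑ i ∈ T, p i * (e - Z i) with hμ
  set c := 1 / (1000 * m ^ 4) with hc
  have hm4 : 0 < m ^ 4 := by positivity
  have hc0 : 0 ≤ c := by positivity
  have hb0 : 0 ≤ b := by
    have hne : T.Nonempty := by
      by_contra h
      rw [Finset.not_nonempty_iff_eq_empty] at h
      simp [h] at hsum
    obtain ⟨i, hi⟩ := hne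
    linarith [(abs_nonneg _).trans (hZ i hi)]
  have hV0 : 0 ≤ V := Finset.sum_nonneg fun i hi => mul_nonneg (hp i hi) (sq_nonneg _)
  have hm2 : m ≤ m ^ 2 := by nlinarith
  have hη0 : 0 ≤ η := by linarith
  have hpt : ∀ i ∈ T, Real.exp (-c * (2 * η * (e - Z i) - 3 / 2 * (e - Z i) ^ 2)) ≤
      1 - c * (2 * η) * (e - Z i) + c * 3 / 2 * (e - Z i) ^ 2 + c * 0.961 * (e - Z i) ^ 2 := by
    intro i hi
    set x := e - Z i
    have h1 := hx i hi
    -- 31 = 2 · 12.5 + (3/2) · 4.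
    have h2 : |2 * η - 3 / 2 * x| ≤ 31 * m ^ 2 := by
      rw [abs_le] at h1 ⊢
      constructor <;> linarith [h1.1, h1.2]
    have h3 : (2 * η * x - 3 / 2 * x ^ 2) = (2 * η - 3 / 2 * x) * x := by ring
    have hmb : m ^ 2 * |x| ≤ 4 * m ^ 4 := by
      calc m ^ 2 * |x| ≤ m ^ 2 * (4 * m ^ 2) := by gcongr; linarith
        _ = 4 * m ^ 4 := by ring
    have h4 : |-c * (2 * η * x - 3 / 2 * x ^ 2)| ≤ 1 := by
      rw [h3, abs_mul, abs_mul, abs_neg, abs_of_nonneg hc0]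
      calc c * (|2 * η - 3 / 2 * x| * |x|) ≤ c * (31 * m ^ 2 * |x|) := by gcongr
        _ ≤ c * (1000 * m ^ 4) := mul_le_mul_of_nonneg_left (by linarith) hc0
        _ = 1 := by rw [hc]; field_simp
    have h5 := (abs_le.mp (Real.abs_exp_sub_one_sub_id_le h4)).2
    -- The quadratic remainder in e^y ≤ 1 + y + y² costs c · 31²/1000 · x². With the original 3/2
    -- this gives the coefficient 2.461 required of the learning rate.
    have h6 : (-c * (2 * η * x - 3 / 2 * x ^ 2)) ^ 2 ≤ c * 0.961 * x ^ 2 := by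
      have : (2 * η - 3 / 2 * x) ^ 2 ≤ 961 * m ^ 4 := by
        calc (2 * η - 3 / 2 * x) ^ 2 = |2 * η - 3 / 2 * x| ^ 2 := (sq_abs _).symm
          _ ≤ (31 * m ^ 2) ^ 2 := by gcongr
          _ = 961 * m ^ 4 := by ring
      calc (-c * (2 * η * x - 3 / 2 * x ^ 2)) ^ 2
          = c * (c * (2 * η - 3 / 2 * x) ^ 2) * x ^ 2 := by rw [h3]; ring
        _ ≤ c * (c * (961 * m ^ 4)) * x ^ 2 := by gcongr
        _ = c * 0.961 * x ^ 2 := by rw [hc]; field_simp; ring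
    linarith
  calc _ ≤ ∑ i ∈ T, p i * (1 - c * (2 * η) * (e - Z i) + c * 3 / 2 * (e - Z i) ^ 2 +
          c * 0.961 * (e - Z i) ^ 2) :=
        Finset.sum_le_sum fun i hi => mul_le_mul_of_nonneg_left (hpt i hi) (hp i hi)
    _ = 1 - c * (2 * η * μ - 2.461 * V) := by
        have : ∀ i, p i * (1 - c * (2 * η) * (e - Z i) + c * 3 / 2 * (e - Z i) ^ 2 +
          c * 0.961 * (e - Z i) ^ 2) = p i - c * (2 * η) * (p i * (e - Z i)) +
            c * 2.461 * (p i * (e - Z i) ^ 2) := fun i => by ring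
        simp only [this, Finset.sum_add_distrib, Finset.sum_sub_distrib, ← Finset.mul_sum, hsum]
        rw [← hμ, ← hV]; ring
    _ ≤ 1 := by
        have hμ0 : 0 ≤ μ :=
          nonneg_of_mul_nonneg_right (hV0.trans hVm) (by linarith)
        have : 2.461 * V ≤ 2 * η * μ := by
          calc 2.461 * V ≤ 2.461 * ((1 + 4 * (2 * b)) * μ) := by gcongr
            _ = 2.461 * (1 + 8 * b) * μ := by ring
            _ ≤ 2 * η * μ := by gcongr
        have := mul_nonneg hc0 (sub_nonneg.mpr this)
        linarith

theorem learningRate_lower (BΦ Bθ : ℝ) :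
    2.461 * (1 + 8 * (BΦ * Bθ)) ≤ 2 * learningRate BΦ Bθ := by
  have he := Real.exp_one_gt_d9
  have : 1.718 * (3 + 4 * (BΦ * Bθ) ^ 2) ≤ learningRate BΦ Bθ := by
    rw [learningRate, mul_pow, ← mul_assoc]
    gcongr
    linarith
  -- The difference of the two sides is bounded below by a quadratic in B_Φ B_θ with negative
  -- discriminant, minimal near 0.716.
  nlinarith [sq_nonneg (BΦ * Bθ - 0.716)]

theorem learningRate_upper {BΦ Bθ : ℝ} (h1 : 0 ≤ BΦ) (h2 : 0 ≤ Bθ) :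
    learningRate BΦ Bθ ≤ 12.5 * max 1 (BΦ * Bθ) ^ 2 := by
  have he := Real.exp_one_lt_d9
  set m := max 1 (BΦ * Bθ)
  have hm1 : 1 ≤ m := le_max_left _ _
  have hm : (BΦ * Bθ) ^ 2 ≤ m ^ 2 :=
    pow_le_pow_left₀ (mul_nonneg h1 h2) (le_max_right _ _) 2
  have : 1 ≤ m ^ 2 := one_le_pow₀ hm1
  calc learningRate BΦ Bθ = (Real.exp 1 - 1) * (3 + 4 * (BΦ * Bθ) ^ 2) := by
        rw [learningRate]; ring
    _ ≤ 1.7183 * (7 * m ^ 2) := by gcongr <;> linarith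
    _ ≤ _ := by linarith

/-! ### Projection onto the ball in the norm of a positive definite matrix. -/

section Newton

variable {d : ℕ}

open Matrix

theorem Matrix.PosDef.dotProduct_mulVec_comm {Q : Matrix (Fin d) (Fin d) ℝ} (hQ : Q.PosDef)
    (x y : Fin d → ℝ) : x ⬝ᵥ Q *ᵥ y = y ⬝ᵥ Q *ᵥ x := by
  have hT : Qᵀ = Q := by simpa [Matrix.conjTranspose_eq_transpose_of_trivial] using hQ.isHermitian.eq
  rw [dotProduct_comm, ← vecMul_transpose, hT, ← dotProduct_mulVec]

theorem Matrix.PosDef.dotProduct_self_nonneg {Q : Matrix (Fin d) (Fin d) ℝ} (hQ : Q.PosDef)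
    (x : Fin d → ℝ) : 0 ≤ x ⬝ᵥ Q *ᵥ x := by
  simpa using hQ.posSemidef.dotProduct_mulVec_nonneg x

theorem matNorm_sq {Q : Matrix (Fin d) (Fin d) ℝ} (hQ : Q.PosDef) (x : EuclideanSpace ℝ (Fin d)) :
    matNorm Q x ^ 2 = x.ofLp ⬝ᵥ Q *ᵥ x.ofLp :=
  Real.sq_sqrt (hQ.dotProduct_self_nonneg _)

theorem Matrix.PosDef.mulVec_inv_mulVec {Q : Matrix (Fin d) (Fin d) ℝ} (hQ : Q.PosDef)
    (x : Fin d → ℝ) : Q *ᵥ Q⁻¹ *ᵥ x = x := by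
  rw [mulVec_mulVec, Matrix.mul_nonsing_inv _ ((Matrix.isUnit_iff_isUnit_det _).mp hQ.isUnit),
    one_mulVec]

/-- First order optimality of a minimizer of `‖· - x‖_Q` over a convex set. -/
theorem dotProduct_mulVec_nonneg_of_isMinOn {Q : Matrix (Fin d) (Fin d) ℝ} (hQ : Q.PosDef)
    {K : Set (EuclideanSpace ℝ (Fin d))} (hK : Convex ℝ K) {x y u : EuclideanSpace ℝ (Fin d)}
    (hy : y ∈ K) (hu : u ∈ K) (hmin : IsMinOn (fun z => matNorm Q (z - x) ^ 2) K y) :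
    0 ≤ (y - x).ofLp ⬝ᵥ Q *ᵥ (u - y).ofLp := by
  set p := (y - x).ofLp ⬝ᵥ Q *ᵥ (u - y).ofLp with hp
  set q := (u - y).ofLp ⬝ᵥ Q *ᵥ (u - y).ofLp with hq
  have hq0 : 0 ≤ q := hQ.dotProduct_self_nonneg _
  have key : ∀ t : ℝ, 0 ≤ t → t ≤ 1 → 0 ≤ t * (2 * p + t * q) := by
    intro t ht0 ht1
    have hz : y + t • (u - y) ∈ K := hK.add_smul_sub_mem hy hu ⟨ht0, ht1⟩
    have h := hmin hz
    simp only [Set.mem_ofPred_eq, matNorm_sq hQ] at h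
    have e : (y + t • (u - y) - x).ofLp = (y - x).ofLp + t • (u - y).ofLp := by
      ext i; simp; ring
    rw [e] at h
    simp only [mulVec_add, dotProduct_add, add_dotProduct, mulVec_smul, dotProduct_smul,
      smul_dotProduct, smul_eq_mul] at h
    rw [hQ.dotProduct_mulVec_comm (u - y).ofLp (y - x).ofLp, ← hp, ← hq] at h
    linarith
  by_contra hneg
  push Not at hneg
  have hpq : 0 < q - p := by linarith
  -- If p < 0, this t lies in (0, 1] and satisfies t q ≤ -p, so 2p + t q ≤ p < 0, contradicting
  -- minimality.
  have h1 := key (-p / (q - p)) (div_nonneg (by linarith) hpq.le)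
    ((div_le_one hpq).mpr (by linarith))
  have h2 : 0 < -p / (q - p) := div_pos (by linarith) hpq
  have h3 := nonneg_of_mul_nonneg_right h1 h2
  have h4 : -p / (q - p) * q ≤ -p := by
    rw [div_mul_eq_mul_div, div_le_iff₀ hpq]
    nlinarith
  linarith

/-- Adding the variational inequalities at the two minimizers gives ‖u - y‖_Q² ≤ 0. This uniqueness
determines the value chosen by `Classical.epsilon` in `ballProj`, which its continuity relies on. -/
theorem eq_of_isMinOn_matNorm {Q : Matrix (Fin d) (Fin d) ℝ} (hQ : Q.PosDef)
    {K : Set (EuclideanSpace ℝ (Fin d))} (hK : Convex ℝ K) {x y u : EuclideanSpace ℝ (Fin d)}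
    (hy : y ∈ K) (hu : u ∈ K) (hymin : IsMinOn (fun z => matNorm Q (z - x) ^ 2) K y)
    (humin : IsMinOn (fun z => matNorm Q (z - x) ^ 2) K u) : y = u := by
  have h1 := dotProduct_mulVec_nonneg_of_isMinOn hQ hK hy hu hymin
  have h2 := dotProduct_mulVec_nonneg_of_isMinOn hQ hK hu hy humin
  by_contra hne
  have h3 : 0 < (u - y).ofLp ⬝ᵥ Q *ᵥ (u - y).ofLp := by
    have : (u - y).ofLp ≠ 0 := by
      intro h0
      exact hne (sub_eq_zero.mp ((WithLp.ofLp_eq_zero 2).mp h0)).symm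
    simpa using hQ.dotProduct_mulVec_pos this
  have e1 : (u - x).ofLp = (y - x).ofLp + (u - y).ofLp := by ext i; simp
  have e2 : (y - u).ofLp = -(u - y).ofLp := by ext i; simp
  rw [e1, e2, mulVec_neg, dotProduct_neg, add_dotProduct] at h2
  linarith

theorem continuous_matNorm_sq :
    Continuous fun p : Matrix (Fin d) (Fin d) ℝ × EuclideanSpace ℝ (Fin d) =>
      matNorm p.1 p.2 ^ 2 := by
  unfold matNorm
  refine (Real.continuous_sqrt.comp ?_).pow 2
  have h2 : Continuous fun p : Matrix (Fin d) (Fin d) ℝ × EuclideanSpace ℝ (Fin d) => p.2.ofLp :=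
    (PiLp.continuous_ofLp 2 _).comp continuous_snd
  exact h2.dotProduct (continuous_fst.matrix_mulVec h2)

theorem ballProj_spec {B : ℝ} (hB : 0 ≤ B) (Q : Matrix (Fin d) (Fin d) ℝ)
    (x : EuclideanSpace ℝ (Fin d)) :
    ballProj B Q x ∈ Metric.closedBall (0 : EuclideanSpace ℝ (Fin d)) B ∧
      IsMinOn (fun z => matNorm Q (z - x) ^ 2) (Metric.closedBall 0 B) (ballProj B Q x) := by
  refine Classical.epsilon_spec (p := fun y => y ∈ Metric.closedBall 0 B ∧
    IsMinOn (fun z => matNorm Q (z - x) ^ 2) (Metric.closedBall 0 B) y) ?_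
  have hc : Continuous fun z : EuclideanSpace ℝ (Fin d) => matNorm Q (z - x) ^ 2 :=
    continuous_matNorm_sq.comp (continuous_const.prodMk (continuous_id.sub continuous_const))
  obtain ⟨y, hy, hm⟩ := (isCompact_closedBall (0 : EuclideanSpace ℝ (Fin d)) B).exists_isMinOn
    ⟨0, by simpa using hB⟩ hc.continuousOn
  exact ⟨y, hy, hm⟩

/-- The projection onto the ball in the norm `‖·‖_Q` does not increase the distance to the points
of the ball. -/
theorem matNorm_ballProj_sub_sq_le {B : ℝ} (hB : 0 ≤ B) {Q : Matrix (Fin d) (Fin d) ℝ}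
    (hQ : Q.PosDef) (x : EuclideanSpace ℝ (Fin d)) {u : EuclideanSpace ℝ (Fin d)}
    (hu : ‖u‖ ≤ B) : matNorm Q (ballProj B Q x - u) ^ 2 ≤ matNorm Q (x - u) ^ 2 := by
  obtain ⟨h1, h2⟩ := ballProj_spec hB Q x
  have h3 := dotProduct_mulVec_nonneg_of_isMinOn hQ (convex_closedBall _ _) h1
    (u := u) (by simpa using hu) h2
  set y := ballProj B Q x
  rw [matNorm_sq hQ, matNorm_sq hQ]
  have e1 : (x - u).ofLp = -((y - x).ofLp + (u - y).ofLp) := by ext i; simp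
  have e2 : (y - u).ofLp = -(u - y).ofLp := by ext i; simp
  rw [e1, e2]
  simp only [mulVec_neg, dotProduct_neg, neg_dotProduct, neg_neg, mulVec_add, dotProduct_add,
    add_dotProduct]
  rw [hQ.dotProduct_mulVec_comm (u - y).ofLp (y - x).ofLp]
  linarith [hQ.dotProduct_self_nonneg (y - x).ofLp]

/-- The projection depends continuously on the positive definite matrix and the point. -/
theorem continuous_ballProj {B : ℝ} (hB : 0 ≤ B) :
    Continuous fun p : {Q : Matrix (Fin d) (Fin d) ℝ // Q.PosDef} × EuclideanSpace ℝ (Fin d) =>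
      ballProj B p.1.1 p.2 := by
  have : CompactSpace (Metric.closedBall (0 : EuclideanSpace ℝ (Fin d)) B) :=
    isCompact_iff_compactSpace.mp (isCompact_closedBall _ _)
  let f : {Q : Matrix (Fin d) (Fin d) ℝ // Q.PosDef} × EuclideanSpace ℝ (Fin d) →
      Metric.closedBall (0 : EuclideanSpace ℝ (Fin d)) B :=
    fun p => ⟨ballProj B p.1.1 p.2, (ballProj_spec hB _ _).1⟩
  suffices Continuous f from continuous_subtype_val.comp this
  -- The minimality relation is closed, and by uniqueness it is the graph of `f`. A map with closed
  -- graph into a compact space is continuous.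
  let G : Set (Metric.closedBall (0 : EuclideanSpace ℝ (Fin d)) B ×
      ({Q : Matrix (Fin d) (Fin d) ℝ // Q.PosDef} × EuclideanSpace ℝ (Fin d))) :=
    {q | ∀ z ∈ Metric.closedBall (0 : EuclideanSpace ℝ (Fin d)) B,
      matNorm q.2.1.1 (q.1.1 - q.2.2) ^ 2 ≤ matNorm q.2.1.1 (z - q.2.2) ^ 2}
  have hG : IsClosed G := by
    simp only [G, Set.ofPred_forall]
    refine isClosed_biInter fun z _ => isClosed_le ?_ ?_
    · exact continuous_matNorm_sq.comp (f := fun q : Metric.closedBall (0 : EuclideanSpace ℝ (Fin d)) B ×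
        ({Q : Matrix (Fin d) (Fin d) ℝ // Q.PosDef} × EuclideanSpace ℝ (Fin d)) =>
          (q.2.1.1, q.1.1 - q.2.2)) (by fun_prop)
    · exact continuous_matNorm_sq.comp (f := fun q : Metric.closedBall (0 : EuclideanSpace ℝ (Fin d)) B ×
        ({Q : Matrix (Fin d) (Fin d) ℝ // Q.PosDef} × EuclideanSpace ℝ (Fin d)) =>
          (q.2.1.1, z - q.2.2)) (by fun_prop)
  have hf : ∀ p y, (y, p) ∈ G ↔ f p = y := by
    intro p y
    constructor
    · intro h
      exact Subtype.ext (eq_of_isMinOn_matNorm p.1.2 (convex_closedBall _ _)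
        (ballProj_spec hB _ _).1 y.2 (ballProj_spec hB _ _).2 h)
    · rintro rfl
      exact (ballProj_spec hB p.1.1 p.2).2
  rw [continuous_iff_isClosed]
  intro C hC
  have : f ⁻¹' C = Prod.snd '' (G ∩ Prod.fst ⁻¹' C) := by
    ext p
    simp only [Set.mem_preimage, Set.mem_image, Set.mem_inter_iff, Prod.exists, exists_eq_right]
    exact ⟨fun h => ⟨f p, (hf p _).mpr rfl, h⟩, fun ⟨y, h1, h2⟩ => by
      rwa [(hf p y).mp h1]⟩
  rw [this]
  exact isClosedMap_snd_of_compactSpace _ (hG.inter (hC.preimage continuous_fst))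

end Newton

/-! ### Online Newton Step: elliptical potential, regret, and the error of the estimator. -/

section Newton

variable {d : ℕ}

open Matrix

theorem outer_mulVec (g x : EuclideanSpace ℝ (Fin d)) :
    outer g *ᵥ x.ofLp = inner ℝ g x • g.ofLp := by
  rw [outer, vecMulVec_mulVec, EuclideanSpace.inner_eq_star_dotProduct, dotProduct_comm]
  simp

theorem dotProduct_outer_mulVec (g x : EuclideanSpace ℝ (Fin d)) :
    x.ofLp ⬝ᵥ outer g *ᵥ x.ofLp = inner ℝ g x ^ 2 := by
  rw [outer_mulVec, dotProduct_smul, EuclideanSpace.inner_eq_star_dotProduct, smul_eq_mul]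
  simp [sq]

theorem posSemidef_outer (g : EuclideanSpace ℝ (Fin d)) : (outer g).PosSemidef := by
  simpa [outer] using posSemidef_vecMulVec_self_star g.ofLp

theorem posDef_obsInfo (ℓ : ℕ → EuclideanSpace ℝ (Fin d) → ℝ) {ε : ℝ} (hε : 0 < ε) (η B : ℝ)
    (k : ℕ) : (obsInfo ℓ ε η B k).PosDef :=
  (PosDef.one.smul hε).posSemidef_add
    (posSemidef_sum _ fun _ _ => posSemidef_outer _)

theorem obsInfo_zero (ℓ : ℕ → EuclideanSpace ℝ (Fin d) → ℝ) (ε η B : ℝ) :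
    obsInfo ℓ ε η B 0 = ε • 1 := by
  simp [obsInfo]

theorem obsInfo_succ (ℓ : ℕ → EuclideanSpace ℝ (Fin d) → ℝ) (ε η B : ℝ) (k : ℕ) :
    obsInfo ℓ ε η B (k + 1) = obsInfo ℓ ε η B k + outer (onsGrad ℓ ε η B (k + 1)) := by
  rw [obsInfo, obsInfo, Finset.sum_Icc_succ_top (by omega), add_right_comm]

theorem onsIterate_zero (ℓ : ℕ → EuclideanSpace ℝ (Fin d) → ℝ) (ε η B : ℝ) :
    onsIterate ℓ ε η B 0 = 0 := rfl

theorem onsIterate_succ (ℓ : ℕ → EuclideanSpace ℝ (Fin d) → ℝ) (ε η B : ℝ) (k : ℕ) :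
    onsIterate ℓ ε η B (k + 1) = ballProj B (obsInfo ℓ ε η B (k + 1))
      (onsIterate ℓ ε η B k -
        η • matApply (obsInfo ℓ ε η B (k + 1))⁻¹ (onsGrad ℓ ε η B (k + 1))) := by
  rw [← onsState_snd]
  rfl

theorem norm_onsIterate_le (ℓ : ℕ → EuclideanSpace ℝ (Fin d) → ℝ) (ε η : ℝ) {B : ℝ} (hB : 0 ≤ B)
    (k : ℕ) : ‖onsIterate ℓ ε η B k‖ ≤ B := by
  cases k with
  | zero => simpa [onsIterate_zero] using hB
  | succ k =>
    rw [onsIterate_succ]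
    simpa using (ballProj_spec hB (obsInfo ℓ ε η B (k + 1)) _).1

/-- One step of the elliptical potential argument. -/
theorem dotProduct_inv_mulVec_le_log_det {A : Matrix (Fin d) (Fin d) ℝ} (hA : A.PosDef)
    (g : EuclideanSpace ℝ (Fin d)) :
    g.ofLp ⬝ᵥ (A + outer g)⁻¹ *ᵥ g.ofLp ≤ Real.log (A + outer g).det - Real.log A.det := by
  have hQ : (A + outer g).PosDef := hA.add_posSemidef (posSemidef_outer g)
  set Q := A + outer g with hQdef
  set w := g.ofLp ⬝ᵥ Q⁻¹ *ᵥ g.ofLp with hw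
  -- The matrix determinant lemma for A = Q(1 - Q⁻¹ g gᵀ). The claim then becomes w ≤ -log(1 - w).
  have hdet : A.det = Q.det * (1 - w) := by
    have h1 : A = Q * (1 + replicateCol Unit (-(Q⁻¹ *ᵥ g.ofLp)) * replicateRow Unit g.ofLp) := by
      rw [Matrix.mul_add, Matrix.mul_one, ← vecMulVec_eq, mul_vecMulVec, mulVec_neg,
        hQ.mulVec_inv_mulVec, hQdef, outer, neg_vecMulVec, add_neg_cancel_right]
    rw [h1, det_mul, det_one_add_replicateCol_mul_replicateRow, dotProduct_neg, ← hw,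
      sub_eq_add_neg]
  have hAd := hA.det_pos
  have hQd := hQ.det_pos
  have h1w : 0 < 1 - w := by
    rw [hdet] at hAd
    exact (pos_iff_pos_of_mul_pos hAd).mp hQd
  rw [hdet, Real.log_mul hQd.ne' h1w.ne']
  have := Real.log_le_sub_one_of_pos h1w
  linarith

/-- Each eigenvalue is at most the trace. This is cruder than the arithmetic-geometric mean bound,
but the loss of a log d per dimension is absorbed by the radius. -/
theorem log_det_le {A : Matrix (Fin d) (Fin d) ℝ} (hA : A.PosDef) {t : ℝ} (ht : A.trace ≤ t) :
    Real.log A.det ≤ d * Real.log t := by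
  have hev : ∀ i, hA.isHermitian.eigenvalues i ≤ t := by
    intro i
    refine le_trans ?_ ht
    have h := hA.isHermitian.trace_eq_sum_eigenvalues
    simp only [RCLike.ofReal_real_eq_id, id] at h
    rw [h]
    exact Finset.single_le_sum (f := hA.isHermitian.eigenvalues)
      (fun j _ => (hA.eigenvalues_pos j).le) (Finset.mem_univ i)
  have h := hA.isHermitian.det_eq_prod_eigenvalues
  simp only [RCLike.ofReal_real_eq_id, id] at h
  rw [h, Real.log_prod fun i _ => (hA.eigenvalues_pos i).ne']
  calc ∑ i, Real.log (hA.isHermitian.eigenvalues i) ≤ ∑ _i : Fin d, Real.log t :=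
        Finset.sum_le_sum fun i _ => Real.log_le_log (hA.eigenvalues_pos i) (hev i)
    _ = d * Real.log t := by simp

theorem trace_outer (g : EuclideanSpace ℝ (Fin d)) : (outer g).trace = ‖g‖ ^ 2 := by
  rw [outer, trace_vecMulVec, EuclideanSpace.norm_sq_eq]
  simp [dotProduct, sq]

theorem trace_obsInfo_le (ℓ : ℕ → EuclideanSpace ℝ (Fin d) → ℝ) (ε η B : ℝ) (k : ℕ) {G : ℝ}
    (hG : ∀ ν ∈ Finset.Icc 1 k, ‖onsGrad ℓ ε η B ν‖ ≤ G) :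
    (obsInfo ℓ ε η B k).trace ≤ d * ε + k * G ^ 2 := by
  rw [obsInfo, trace_add, trace_sum, trace_smul, trace_one]
  have : ∑ ν ∈ Finset.Icc 1 k, (outer (onsGrad ℓ ε η B ν)).trace ≤
      ∑ ν ∈ Finset.Icc 1 k, G ^ 2 := Finset.sum_le_sum fun ν hν => by
    rw [trace_outer]
    gcongr
    exact hG ν hν
  simp only [Finset.sum_const, Nat.card_Icc, nsmul_eq_mul, smul_eq_mul, Fintype.card_fin,
    Nat.add_sub_cancel] at this ⊢
  linarith

/-- Projecting does not increase the distance to u, so the unprojected Newton step may be expanded.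
Passing from Q to A = Q - g gᵀ produces the square ⟨g, w⟩², and η² gᵀ Q⁻¹ g is paid for by the
growth of log det. -/
theorem ons_step (ℓ : ℕ → EuclideanSpace ℝ (Fin d) → ℝ) {ε : ℝ} (hε : 0 < ε) (η : ℝ) {B : ℝ}
    (hB : 0 ≤ B) {u : EuclideanSpace ℝ (Fin d)} (hu : ‖u‖ ≤ B) (k : ℕ) :
    matNorm (obsInfo ℓ ε η B (k + 1)) (onsIterate ℓ ε η B (k + 1) - u) ^ 2 ≤
      matNorm (obsInfo ℓ ε η B k) (onsIterate ℓ ε η B k - u) ^ 2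
      - (2 * η * inner ℝ (onsGrad ℓ ε η B (k + 1)) (onsIterate ℓ ε η B k - u)
        - inner ℝ (onsGrad ℓ ε η B (k + 1)) (onsIterate ℓ ε η B k - u) ^ 2)
      + η ^ 2 * (Real.log (obsInfo ℓ ε η B (k + 1)).det - Real.log (obsInfo ℓ ε η B k).det) := by
  have hQ := posDef_obsInfo ℓ hε η B (k + 1)
  have hA := posDef_obsInfo ℓ hε η B k
  have hlog := dotProduct_inv_mulVec_le_log_det hA (onsGrad ℓ ε η B (k + 1))
  rw [← obsInfo_succ] at hlog
  rw [onsIterate_succ]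
  refine (matNorm_ballProj_sub_sq_le hB hQ _ hu).trans ?_
  set Q := obsInfo ℓ ε η B (k + 1) with hQd
  set A := obsInfo ℓ ε η B k with hAd
  set g := onsGrad ℓ ε η B (k + 1)
  set w := onsIterate ℓ ε η B k - u with hw
  have e : (onsIterate ℓ ε η B k - η • matApply Q⁻¹ g - u).ofLp
      = w.ofLp - η • (Q⁻¹ *ᵥ g.ofLp) := by
    ext i; simp [hw, matApply]; ring
  have hwQ : w.ofLp ⬝ᵥ Q *ᵥ w.ofLp = w.ofLp ⬝ᵥ A *ᵥ w.ofLp + inner ℝ g w ^ 2 := by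
    rw [hQd, obsInfo_succ, add_mulVec, dotProduct_add, dotProduct_outer_mulVec]
  have hgw : w.ofLp ⬝ᵥ g.ofLp = inner ℝ g w := by
    rw [EuclideanSpace.inner_eq_star_dotProduct]; simp
  rw [matNorm_sq hQ, matNorm_sq hA, e]
  simp only [mulVec_sub, dotProduct_sub, sub_dotProduct, mulVec_smul, dotProduct_smul,
    smul_dotProduct, smul_eq_mul, hQ.mulVec_inv_mulVec]
  rw [hQ.dotProduct_mulVec_comm (Q⁻¹ *ᵥ g.ofLp) w.ofLp, hQ.mulVec_inv_mulVec, hwQ, hgw,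
    dotProduct_comm (Q⁻¹ *ᵥ g.ofLp) g.ofLp]
  nlinarith [mul_le_mul_of_nonneg_left hlog (sq_nonneg η)]

/-- The regret inequality of the projected Online Newton Step. -/
theorem ons_regret (ℓ : ℕ → EuclideanSpace ℝ (Fin d) → ℝ) {ε : ℝ} (hε : 0 < ε) (η : ℝ) {B : ℝ}
    (hB : 0 ≤ B) {u : EuclideanSpace ℝ (Fin d)} (hu : ‖u‖ ≤ B) (k : ℕ) {G : ℝ}
    (hG : ∀ ν ∈ Finset.Icc 1 k, ‖onsGrad ℓ ε η B ν‖ ≤ G) :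
    ∑ ν ∈ Finset.Icc 1 k,
      (2 * η * inner ℝ (onsGrad ℓ ε η B ν) (onsIterate ℓ ε η B (ν - 1) - u)
        - inner ℝ (onsGrad ℓ ε η B ν) (onsIterate ℓ ε η B (ν - 1) - u) ^ 2) ≤
      ε * B ^ 2 + η ^ 2 * (d * Real.log (d + k * G ^ 2 / ε)) := by
  -- The squared distance to u is kept on the left as a potential, so that the steps telescope; it
  -- is dropped at the end.
  have htel : ∀ j, ∑ ν ∈ Finset.Icc 1 j,
      (2 * η * inner ℝ (onsGrad ℓ ε η B ν) (onsIterate ℓ ε η B (ν - 1) - u)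
        - inner ℝ (onsGrad ℓ ε η B ν) (onsIterate ℓ ε η B (ν - 1) - u) ^ 2)
      + matNorm (obsInfo ℓ ε η B j) (onsIterate ℓ ε η B j - u) ^ 2 ≤
      ε * ‖u‖ ^ 2 + η ^ 2 * (Real.log (obsInfo ℓ ε η B j).det - d * Real.log ε) := by
    intro j
    induction j with
    | zero =>
      rw [matNorm_sq (posDef_obsInfo ℓ hε η B 0), obsInfo_zero, onsIterate_zero, det_smul]
      have : ‖u‖ ^ 2 = u.ofLp ⬝ᵥ u.ofLp := by
        rw [EuclideanSpace.norm_sq_eq]; simp [dotProduct, sq]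
      simp [this, smul_mulVec]
    | succ j ih =>
      rw [Finset.sum_Icc_succ_top (by omega), Nat.add_sub_cancel]
      linarith [ons_step ℓ hε η hB hu j]
  have h1 := htel k
  -- For d = 0 the argument of the logarithm on the right may vanish, which would block splitting
  -- log(ε · …).
  rcases Nat.eq_zero_or_pos d with hd | hd
  · subst hd
    have h2 : ε * ‖u‖ ^ 2 ≤ ε * B ^ 2 := by gcongr
    simp only [det_isEmpty, Real.log_one, Nat.cast_zero, zero_mul, sub_zero, mul_zero,
      add_zero] at h1 ⊢
    linarith [sq_nonneg (matNorm (obsInfo ℓ ε η B k) (onsIterate ℓ ε η B k - u))]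
  have h2 : ε * ‖u‖ ^ 2 ≤ ε * B ^ 2 := by gcongr
  have h3 := log_det_le (posDef_obsInfo ℓ hε η B k) (trace_obsInfo_le ℓ ε η B k hG)
  have h4 : d * ε + k * G ^ 2 = ε * (d + k * G ^ 2 / ε) := by field_simp
  have hd' : (0 : ℝ) < d := by exact_mod_cast hd
  rw [h4, Real.log_mul hε.ne' (by positivity)] at h3
  have h5 : η ^ 2 * (Real.log (obsInfo ℓ ε η B k).det - d * Real.log ε) ≤
      η ^ 2 * (d * Real.log (d + k * G ^ 2 / ε)) := by gcongr; linarith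
  linarith [sq_nonneg (matNorm (obsInfo ℓ ε η B k) (onsIterate ℓ ε η B k - u))]

/-- The error of the estimator is controlled by the regularization and the squared linearized
regret. -/
theorem matNorm_estimator_sub_le (ℓ : ℕ → EuclideanSpace ℝ (Fin d) → ℝ) {ε : ℝ} (hε : 0 < ε)
    (η : ℝ) {B : ℝ} {u : EuclideanSpace ℝ (Fin d)} (hu : ‖u‖ ≤ B) (k : ℕ) :
    matNorm (obsInfo ℓ ε η B k) (estimator ℓ ε η B k - u) ≤ Real.sqrt ε * B +
      Real.sqrt (∑ ν ∈ Finset.Icc 1 k,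
        inner ℝ (onsGrad ℓ ε η B ν) (onsIterate ℓ ε η B (ν - 1) - u) ^ 2) := by
  have hQ := posDef_obsInfo ℓ hε η B k
  set Q := obsInfo ℓ ε η B k with hQd
  set r := estimator ℓ ε η B k - u with hr
  set g := onsGrad ℓ ε η B
  set θ := onsIterate ℓ ε η B
  set N := matNorm Q r with hN
  have hN0 : 0 ≤ N := Real.sqrt_nonneg _
  have hQmul : ∀ x : EuclideanSpace ℝ (Fin d), Q *ᵥ x.ofLp =
      ∑ ν ∈ Finset.Icc 1 k, inner ℝ (g ν) x • (g ν).ofLp + ε • x.ofLp := by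
    intro x
    rw [hQd, obsInfo, add_mulVec, sum_mulVec, smul_mulVec, one_mulVec]
    simp only [outer_mulVec, g]
  have hgr : ∀ x y : EuclideanSpace ℝ (Fin d), x.ofLp ⬝ᵥ y.ofLp = inner ℝ y x := fun x y => by
    rw [EuclideanSpace.inner_eq_star_dotProduct]; simp
  have hNsq : N ^ 2 = ∑ ν ∈ Finset.Icc 1 k, inner ℝ (g ν) r ^ 2 + ε * ‖r‖ ^ 2 := by
    rw [hN, matNorm_sq hQ, hQmul, dotProduct_add, dotProduct_sum]
    simp only [dotProduct_smul, smul_eq_mul]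
    simp only [hgr, real_inner_self_eq_norm_sq, sq]
  -- A second expression for N², from the normal equation. Cauchy–Schwarz bounds it by N(√X + √ε B),
  -- the first expression controlling the factors involving r; dividing by N finishes.
  have hNsq' : N ^ 2 = ∑ ν ∈ Finset.Icc 1 k, inner ℝ (g ν) r * inner ℝ (g ν) (θ (ν - 1) - u)
      - ε * inner ℝ u r := by
    have hest : Q *ᵥ (estimator ℓ ε η B k).ofLp =
        ∑ ν ∈ Finset.Icc 1 k, inner ℝ (g ν) (θ (ν - 1)) • (g ν).ofLp := by
      rw [estimator, matApply, ← hQd]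
      change Q *ᵥ Q⁻¹ *ᵥ _ = _
      rw [hQ.mulVec_inv_mulVec, WithLp.ofLp_sum]
      refine Finset.sum_congr rfl fun ν _ => ?_
      rw [matApply, outer_mulVec]
    rw [hN, matNorm_sq hQ]
    have : Q *ᵥ r.ofLp = ∑ ν ∈ Finset.Icc 1 k, inner ℝ (g ν) (θ (ν - 1) - u) • (g ν).ofLp
        - ε • u.ofLp := by
      rw [hr, WithLp.ofLp_sub, mulVec_sub, hest, hQmul]
      simp only [inner_sub_right, sub_smul, Finset.sum_sub_distrib]
      abel
    rw [this, dotProduct_sub, dotProduct_sum]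
    simp only [dotProduct_smul, smul_eq_mul]
    simp only [hgr, mul_comm]
  set X := ∑ ν ∈ Finset.Icc 1 k, inner ℝ (g ν) (θ (ν - 1) - u) ^ 2
  have hB : 0 ≤ B := (norm_nonneg _).trans hu
  have hcs : ∑ ν ∈ Finset.Icc 1 k, inner ℝ (g ν) r * inner ℝ (g ν) (θ (ν - 1) - u) ≤
      N * Real.sqrt X := by
    refine (Real.sum_mul_le_sqrt_mul_sqrt _ _ _).trans ?_
    gcongr
    rw [← Real.sqrt_sq hN0, hNsq]
    exact Real.sqrt_le_sqrt (le_add_of_nonneg_right (by positivity))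
  have hεr : Real.sqrt ε * ‖r‖ ≤ N := by
    rw [← Real.sqrt_sq hN0, hNsq, ← Real.sqrt_sq (norm_nonneg r), ← Real.sqrt_mul hε.le,
      Real.sqrt_sq (norm_nonneg r)]
    exact Real.sqrt_le_sqrt (le_add_of_nonneg_left (Finset.sum_nonneg fun _ _ => sq_nonneg _))
  have hεu : -(ε * inner ℝ u r) ≤ N * (Real.sqrt ε * B) := by
    have h1 : -inner ℝ u r ≤ ‖u‖ * ‖r‖ := by
      have := real_inner_le_norm (-u) r
      rwa [inner_neg_left, norm_neg] at this
    calc -(ε * inner ℝ u r) = Real.sqrt ε * Real.sqrt ε * -inner ℝ u r := by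
          rw [Real.mul_self_sqrt hε.le]; ring
      _ ≤ Real.sqrt ε * Real.sqrt ε * (‖u‖ * ‖r‖) := by gcongr
      _ = (Real.sqrt ε * ‖r‖) * (Real.sqrt ε * ‖u‖) := by ring
      _ ≤ N * (Real.sqrt ε * B) := by gcongr
  rcases hN0.eq_or_lt with h0 | h0
  · rw [← h0]; positivity
  · refine le_of_mul_le_mul_left ?_ h0
    rw [← sq, hNsq']
    linarith

end Newton

/-! ### Measurability of the iterates. -/

section Adapted

variable {d : ℕ}

open Matrix

theorem continuous_ballProj_newton {B : ℝ} (hB : 0 ≤ B) (η : ℝ) :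
    Continuous fun p : {Q : Matrix (Fin d) (Fin d) ℝ // Q.PosDef} ×
        EuclideanSpace ℝ (Fin d) × EuclideanSpace ℝ (Fin d) =>
      ballProj B p.1.1 (p.2.1 - η • matApply p.1.1⁻¹ p.2.2) := by
  have hinv : Continuous fun q : {Q : Matrix (Fin d) (Fin d) ℝ // Q.PosDef} => q.1⁻¹ := by
    simp only [Matrix.inv_def, Ring.inverse_eq_inv']
    exact (continuous_subtype_val.matrix_det.inv₀ fun q => q.2.det_pos.ne').smul
      continuous_subtype_val.matrix_adjugate
  have happ : Continuous fun p : {Q : Matrix (Fin d) (Fin d) ℝ // Q.PosDef} ×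
      EuclideanSpace ℝ (Fin d) × EuclideanSpace ℝ (Fin d) => matApply p.1.1⁻¹ p.2.2 := by
    unfold matApply
    refine (PiLp.continuous_toLp 2 _).comp ?_
    exact (hinv.comp continuous_fst).matrix_mulVec
      ((PiLp.continuous_ofLp 2 _).comp (continuous_snd.comp continuous_snd))
  exact (continuous_ballProj hB).comp (f := fun p : {Q : Matrix (Fin d) (Fin d) ℝ // Q.PosDef} ×
    EuclideanSpace ℝ (Fin d) × EuclideanSpace ℝ (Fin d) =>
      (p.1, p.2.1 - η • matApply p.1.1⁻¹ p.2.2))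
    (continuous_fst.prodMk ((continuous_fst.comp continuous_snd).sub (happ.const_smul η)))

/-- The update of the projected Online Newton Step is a measurable function of the matrix entries,
the iterate and the gradient. -/
theorem measurable_ballProj_newton {Ω : Type*} {m : MeasurableSpace Ω} {B : ℝ} (hB : 0 ≤ B) (η : ℝ)
    {Q : Ω → Matrix (Fin d) (Fin d) ℝ} {θ g : Ω → EuclideanSpace ℝ (Fin d)}
    (hQ : ∀ ω, (Q ω).PosDef) (hQm : ∀ i j, Measurable fun ω => Q ω i j)
    (hθ : Measurable θ) (hg : Measurable g) :
    Measurable fun ω => ballProj B (Q ω) (θ ω - η • matApply (Q ω)⁻¹ (g ω)) := by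
  -- Matrices are replaced by arrays of entries, for which entrywise measurability gives joint
  -- measurability.
  have hemb : Continuous fun q : {q : Fin d → Fin d → ℝ // (Matrix.of q).PosDef} =>
      (⟨Matrix.of q.1, q.2⟩ : {Q : Matrix (Fin d) (Fin d) ℝ // Q.PosDef}) :=
    Continuous.subtype_mk (continuous_matrix fun i j =>
      (continuous_apply_apply i j).comp continuous_subtype_val) _
  have hcont : Continuous fun p : {q : Fin d → Fin d → ℝ // (Matrix.of q).PosDef} ×
      EuclideanSpace ℝ (Fin d) × EuclideanSpace ℝ (Fin d) =>
      ballProj B (Matrix.of p.1.1) (p.2.1 - η • matApply (Matrix.of p.1.1)⁻¹ p.2.2) :=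
    (continuous_ballProj_newton hB η).comp ((hemb.comp continuous_fst).prodMk continuous_snd)
  have hq : Measurable fun ω => (⟨fun i j => Q ω i j, hQ ω⟩ :
      {q : Fin d → Fin d → ℝ // (Matrix.of q).PosDef}) :=
    Measurable.subtype_mk (measurable_pi_lambda _ fun i => measurable_pi_lambda _ fun j => hQm i j)
  have hp := hq.prodMk (hθ.prodMk hg)
  have h2 := hcont.measurable.comp hp
  have hof : ∀ ω, (Matrix.of fun i j => Q ω i j) = Q ω := fun _ => rfl
  simpa only [Function.comp_def, hof] using h2

/-- If the gradients of the first `n` losses are measurable, so are the first `n` iterates. -/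
theorem measurable_onsIterate {Ω : Type*} {m : MeasurableSpace Ω}
    (ℓ : Ω → ℕ → EuclideanSpace ℝ (Fin d) → ℝ) {ε : ℝ} (hε : 0 < ε) (η : ℝ) {B : ℝ} (hB : 0 ≤ B)
    (n : ℕ) (hℓ : ∀ ν ∈ Finset.Icc 1 n, ∀ θ : Ω → EuclideanSpace ℝ (Fin d), Measurable θ →
      Measurable fun ω => gradient (ℓ ω ν) (θ ω)) :
    ∀ k ≤ n, Measurable (fun ω => onsIterate (ℓ ω) ε η B k) := by
  -- The update reads both the iterate and the matrix, so the induction carries both.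
  suffices ∀ k ≤ n, Measurable (fun ω => onsIterate (ℓ ω) ε η B k) ∧
      ∀ i j, Measurable fun ω => obsInfo (ℓ ω) ε η B k i j from fun k hk => (this k hk).1
  intro k
  induction k with
  | zero =>
    intro _
    simp only [onsIterate_zero, obsInfo_zero]
    exact ⟨measurable_const, fun _ _ => measurable_const⟩
  | succ k ih =>
    intro hk
    obtain ⟨h1, h2⟩ := ih (by omega)
    have hg : Measurable fun ω => onsGrad (ℓ ω) ε η B (k + 1) :=
      hℓ (k + 1) (Finset.mem_Icc.mpr ⟨by omega, hk⟩) _ h1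
    have hQ : ∀ i j, Measurable fun ω => obsInfo (ℓ ω) ε η B (k + 1) i j := by
      intro i j
      simp only [obsInfo_succ, Matrix.add_apply, outer, Matrix.vecMulVec_apply]
      have hgi : ∀ i, Measurable fun ω => (onsGrad (ℓ ω) ε η B (k + 1)).ofLp i := fun i =>
        ((EuclideanSpace.proj (𝕜 := ℝ) i).continuous.measurable).comp hg
      exact (h2 i j).add ((hgi i).mul (hgi j))
    refine ⟨?_, hQ⟩
    simp only [onsIterate_succ]
    exact measurable_ballProj_newton hB η (fun ω => posDef_obsInfo (ℓ ω) hε η B (k + 1)) hQ h1 hg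

end Adapted

/-- Allows the random states to be frozen at fixed values; only actions and parameters then need
measurable dependence. -/
theorem Measurable.comp_countable_index {Ω S β : Type*} {m : MeasurableSpace Ω} [MeasurableSpace S]
    [Countable S] [MeasurableSingletonClass S] [MeasurableSpace β] {f : S → Ω → β} {g : Ω → S}
    (hf : ∀ s, Measurable (f s)) (hg : Measurable g) : Measurable fun ω => f (g ω) ω :=
  (measurable_from_prod_countable_right (f := Function.uncurry f) hf).comp
    (hg.prodMk measurable_id)

/-! ### The multinomial logit gradient as a tilted mean. -/

namespace MNLModel

variable {S A : Type*} [MeasurableSpace A] {d H : ℕ}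

/-- The gradient of the negative log-likelihood. -/
noncomputable def nllGrad (M : MNLModel S A d H) (h : Fin H) (s : S) (a : A) (s' : S)
    (θ : EuclideanSpace ℝ (Fin d)) : EuclideanSpace ℝ (Fin d) :=
  (∑ t ∈ M.reach h s a, Real.exp (inner ℝ (M.feature s a t) θ))⁻¹ •
    ∑ t ∈ M.reach h s a, Real.exp (inner ℝ (M.feature s a t) θ) • M.feature s a t -
      M.feature s a s'

theorem sum_exp_pos (M : MNLModel S A d H) (h : Fin H) (s : S) (a : A)
    (θ : EuclideanSpace ℝ (Fin d)) :
    0 < ∑ t ∈ M.reach h s a, Real.exp (inner ℝ (M.feature s a t) θ) :=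
  Finset.sum_pos (fun _ _ => Real.exp_pos _) (M.reach_nonempty h s a)

theorem gradient_nll (M : MNLModel S A d H) (h : Fin H) (s : S) (a : A) (s' : S)
    (θ : EuclideanSpace ℝ (Fin d)) :
    gradient (M.nll h s a s') θ = M.nllGrad h s a s' θ := by
  refine HasGradientAt.gradient ?_
  rw [hasGradientAt_iff_hasFDerivAt]
  have hin : ∀ t, HasFDerivAt (fun θ : EuclideanSpace ℝ (Fin d) => inner ℝ (M.feature s a t) θ)
      (innerSL ℝ (M.feature s a t)) θ := fun t => (innerSL ℝ (M.feature s a t)).hasFDerivAt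
  have hsum := HasFDerivAt.fun_sum (u := M.reach h s a) fun t _ => (hin t).exp
  have := ((hin s').neg).add (hsum.log (M.sum_exp_pos h s a θ).ne')
  refine this.congr_fderiv ?_
  ext v
  simp [nllGrad]
  ring

theorem measurable_nllGrad [Fintype S] [MeasurableSpace S] [MeasurableSingletonClass S]
    (M : MNLModel S A d H) (h : Fin H) {Ω : Type*} {m : MeasurableSpace Ω} {s s' : Ω → S}
    {a : Ω → A} {θ : Ω → EuclideanSpace ℝ (Fin d)} (hs : Measurable s) (ha : Measurable a)
    (hs' : Measurable s') (hθ : Measurable θ) :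
    Measurable fun ω => M.nllGrad h (s ω) (a ω) (s' ω) (θ ω) := by
  classical
  refine Measurable.comp_countable_index
    (f := fun s ω => M.nllGrad h s (a ω) (s' ω) (θ ω)) (fun s => ?_) hs
  refine Measurable.comp_countable_index
    (f := fun s' ω => M.nllGrad h s (a ω) s' (θ ω)) (fun s' => ?_) hs'
  have hφ : ∀ t, Measurable fun ω => M.feature s (a ω) t := fun t => (M.measurable_feature s t).comp ha
  have hexp : ∀ t, Measurable fun ω => Real.exp (inner ℝ (M.feature s (a ω) t) (θ ω)) :=
    fun t => ((hφ t).inner hθ).exp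
  have hr : ∀ t, MeasurableSet {ω | t ∈ M.reach h s (a ω)} := fun t =>
    ha (M.measurableSet_reach h s t)
  unfold nllGrad
  -- The reachable set varies with the action, so the sum is extended to all states, with measurable
  -- membership conditions.
  have e1 : ∀ ω, ∑ t ∈ M.reach h s (a ω), Real.exp (inner ℝ (M.feature s (a ω) t) (θ ω)) =
      ∑ t, if t ∈ M.reach h s (a ω) then Real.exp (inner ℝ (M.feature s (a ω) t) (θ ω)) else 0 :=
    fun ω => by rw [Finset.sum_ite_mem, Finset.univ_inter]
  have e2 : ∀ ω, ∑ t ∈ M.reach h s (a ω),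
      Real.exp (inner ℝ (M.feature s (a ω) t) (θ ω)) • M.feature s (a ω) t =
      ∑ t, if t ∈ M.reach h s (a ω) then
        Real.exp (inner ℝ (M.feature s (a ω) t) (θ ω)) • M.feature s (a ω) t else 0 :=
    fun ω => by rw [Finset.sum_ite_mem, Finset.univ_inter]
  simp only [e1, e2]
  refine Measurable.sub (Measurable.fun_smul (Measurable.inv ?_) ?_) (hφ s')
  · exact Finset.measurable_fun_sum _ fun t _ => Measurable.ite (hr t) (hexp t) measurable_const
  · exact Finset.measurable_fun_sum _ fun t _ =>
      Measurable.ite (hr t) ((hexp t).smul (hφ t)) measurable_const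

theorem norm_nllGrad_le (M : MNLModel S A d H) {BΦ : ℝ} (hM : ∀ s a s', ‖M.feature s a s'‖ ≤ BΦ)
    (h : Fin H) (s : S) (a : A) (s' : S) (θ : EuclideanSpace ℝ (Fin d)) :
    ‖M.nllGrad h s a s' θ‖ ≤ 2 * BΦ := by
  have hpos := M.sum_exp_pos h s a θ
  refine (norm_sub_le _ _).trans ?_
  have h1 : ‖∑ t ∈ M.reach h s a, Real.exp (inner ℝ (M.feature s a t) θ) • M.feature s a t‖ ≤
      (∑ t ∈ M.reach h s a, Real.exp (inner ℝ (M.feature s a t) θ)) * BΦ := by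
    rw [Finset.sum_mul]
    refine norm_sum_le_of_le _ fun t _ => ?_
    rw [norm_smul, Real.norm_eq_abs, Real.abs_exp]
    gcongr
    exact hM s a t
  have h2 : ‖(∑ t ∈ M.reach h s a, Real.exp (inner ℝ (M.feature s a t) θ))⁻¹ •
      ∑ t ∈ M.reach h s a, Real.exp (inner ℝ (M.feature s a t) θ) • M.feature s a t‖ ≤ BΦ := by
    rw [norm_smul, norm_inv, Real.norm_of_nonneg hpos.le, inv_mul_le_iff₀ hpos]
    exact h1
  linarith [hM s a s']

/-- The transition probabilities under `θ` are an exponential tilting of those under `θ₀`. -/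
theorem inner_nllGrad (M : MNLModel S A d H) (h : Fin H) (s : S) (a : A) (s' : S)
    (θ θ₀ v : EuclideanSpace ℝ (Fin d)) :
    inner ℝ (M.nllGrad h s a s' θ) v =
      (∑ t ∈ M.reach h s a, M.transProb h s a θ₀ t *
        Real.exp (inner ℝ (M.feature s a t) (θ - θ₀)) * inner ℝ (M.feature s a t) v) /
      (∑ t ∈ M.reach h s a, M.transProb h s a θ₀ t *
        Real.exp (inner ℝ (M.feature s a t) (θ - θ₀))) - inner ℝ (M.feature s a s') v := by
  have hpos := M.sum_exp_pos h s a θ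
  have hpos0 := M.sum_exp_pos h s a θ₀
  -- Reweighting turns the numerator for θ₀ into that for θ; the leftover normalizer of θ₀ cancels
  -- in the quotient.
  have ht : ∀ t ∈ M.reach h s a, M.transProb h s a θ₀ t *
      Real.exp (inner ℝ (M.feature s a t) (θ - θ₀)) =
      Real.exp (inner ℝ (M.feature s a t) θ) /
        ∑ t ∈ M.reach h s a, Real.exp (inner ℝ (M.feature s a t) θ₀) := by
    intro t htm
    rw [transProb, if_pos htm, inner_sub_right, div_mul_eq_mul_div, ← Real.exp_add]
    congr 2
    ring
  rw [Finset.sum_congr rfl ht, Finset.sum_congr rfl fun t htm => by rw [ht t htm],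
    nllGrad, inner_sub_left, real_inner_smul_left, sum_inner]
  simp only [real_inner_smul_left, div_mul_eq_mul_div, ← Finset.sum_div]
  congr 1
  field_simp

theorem transProb_nonneg (M : MNLModel S A d H) (h : Fin H) (s : S) (a : A)
    (θ : EuclideanSpace ℝ (Fin d)) (s' : S) : 0 ≤ M.transProb h s a θ s' := by
  unfold transProb
  split_ifs
  · exact div_nonneg (Real.exp_pos _).le (M.sum_exp_pos h s a θ).le
  · exact le_rfl

theorem sum_transProb (M : MNLModel S A d H) (h : Fin H) (s : S) (a : A)
    (θ : EuclideanSpace ℝ (Fin d)) : ∑ t ∈ M.reach h s a, M.transProb h s a θ t = 1 := by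
  rw [Finset.sum_congr rfl fun t ht => by rw [transProb, if_pos ht], ← Finset.sum_div,
    div_self (M.sum_exp_pos h s a θ).ne']

/-- The conditional exponential moment of a transition is at most one. -/
theorem sum_transProb_mul_exp_le_one [Fintype S] (M : MNLModel S A d H) {BΦ Bθ : ℝ}
    (hB1 : 0 ≤ BΦ) (hB2 : 0 ≤ Bθ) (hM : ∀ s a s', ‖M.feature s a s'‖ ≤ BΦ)
    (h : Fin H) (s : S) (a : A) {θ θ₀ : EuclideanSpace ℝ (Fin d)} (hθ : ‖θ‖ ≤ Bθ)
    (hθ₀ : ‖θ₀‖ ≤ Bθ) :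
    ∑ t, M.transProb h s a θ₀ t * Real.exp (-(1 / (1000 * max 1 (BΦ * Bθ) ^ 4)) *
      (2 * learningRate BΦ Bθ * inner ℝ (M.nllGrad h s a t θ) (θ - θ₀) -
        3 / 2 * inner ℝ (M.nllGrad h s a t θ) (θ - θ₀) ^ 2)) ≤ 1 := by
  have hv : ‖θ - θ₀‖ ≤ 2 * Bθ := (norm_sub_le _ _).trans (by linarith)
  rw [← Finset.sum_subset (Finset.subset_univ (M.reach h s a)) fun t _ ht => by
    rw [transProb, if_neg ht, zero_mul]]
  have hx : ∀ t, |inner ℝ (M.nllGrad h s a t θ) (θ - θ₀)| ≤ 4 * (BΦ * Bθ) := fun t => by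
    calc _ ≤ ‖M.nllGrad h s a t θ‖ * ‖θ - θ₀‖ := abs_real_inner_le_norm _ _
      _ ≤ (2 * BΦ) * (2 * Bθ) := by
        gcongr
        exact M.norm_nllGrad_le hM h s a t θ
      _ = _ := by ring
  simp only [M.inner_nllGrad h s a _ θ θ₀ (θ - θ₀)] at hx ⊢
  refine sum_tilt_exp_le_one (M.reach h s a) (M.transProb h s a θ₀)
    (fun t => inner ℝ (M.feature s a t) (θ - θ₀)) (b := BΦ * Bθ)
    (fun t _ => M.transProb_nonneg h s a θ₀ t) (M.sum_transProb h s a θ₀) (fun t _ => ?_) rfl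
    (fun t _ => hx t) (learningRate_lower BΦ Bθ) (le_max_left _ _) (le_max_right _ _)
    (learningRate_upper hB1 hB2)
  calc _ ≤ ‖M.feature s a t‖ * ‖θ - θ₀‖ := abs_real_inner_le_norm _ _
    _ ≤ BΦ * (2 * Bθ) := by
      gcongr
      exact hM s a t
    _ = _ := by ring

end MNLModel

/-! ### A maximal inequality for products, and testing against a conditional law. -/

section Ville

/-- The product of the `F ν`, frozen as soon as it reaches the level `c`. -/
noncomputable def frozenProd {Ω : Type*} (F : ℕ → Ω → ℝ) (c : ℝ) : ℕ → Ω → ℝ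
  | 0 => fun _ => 1
  | k + 1 => fun ω =>
    if frozenProd F c k ω < c then frozenProd F c k ω * F (k + 1) ω else frozenProd F c k ω

theorem frozenProd_nonneg {Ω : Type*} {F : ℕ → Ω → ℝ} (hF : ∀ k ω, 0 ≤ F k ω) (c : ℝ) (k : ℕ)
    (ω : Ω) : 0 ≤ frozenProd F c k ω := by
  induction k with
  | zero => exact zero_le_one
  | succ k ih =>
    simp only [frozenProd]
    split_ifs
    · exact mul_nonneg ih (hF _ _)
    · exact ih

theorem exists_frozenProd_le {Ω : Type*} {F : ℕ → Ω → ℝ} (hF : ∀ k ω, 0 ≤ F k ω) {D : ℝ}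
    (hFD : ∀ k ω, F k ω ≤ D) (c : ℝ) (k : ℕ) : ∃ C, ∀ ω, frozenProd F c k ω ≤ C := by
  induction k with
  | zero => exact ⟨1, fun _ => le_rfl⟩
  | succ k ih =>
    obtain ⟨C, hC⟩ := ih
    refine ⟨max (C * D) C, fun ω => ?_⟩
    simp only [frozenProd]
    split_ifs
    · exact le_max_of_le_left (mul_le_mul (hC ω) (hFD _ _) (hF _ _)
        ((frozenProd_nonneg hF c k ω).trans (hC ω)))
    · exact le_max_of_le_right (hC ω)

theorem measurable_frozenProd {Ω : Type*} {m : MeasurableSpace Ω} {F : ℕ → Ω → ℝ} (c : ℝ) (k : ℕ)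
    (hF : ∀ ν ∈ Finset.Icc 1 k, Measurable (F ν)) : Measurable (frozenProd F c k) := by
  induction k with
  | zero => exact measurable_const
  | succ k ih =>
    have h := ih fun ν hν => hF ν (Finset.Icc_subset_Icc_right (Nat.le_succ k) hν)
    exact Measurable.ite (measurableSet_lt h measurable_const)
      (h.mul (hF (k + 1) (by simp))) h

/-- A frozen value stays at or above c forever. A final value below c therefore means that freezing
never happened and the process was the running product throughout, so Markov's inequality at time K
controls all k ≤ K. -/
theorem prod_lt_of_frozenProd_lt {Ω : Type*} (F : ℕ → Ω → ℝ) (c : ℝ) (K : ℕ) (ω : Ω)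
    (h : frozenProd F c K ω < c) : ∀ k ≤ K, ∏ ν ∈ Finset.Icc 1 k, F ν ω < c := by
  have hlt : ∀ k ≤ K, frozenProd F c k ω < c := by
    intro k hk
    induction hk using Nat.decreasingInduction with
    | self => exact h
    | of_succ k _ ih =>
      by_contra hge
      simp only [frozenProd, if_neg hge] at ih
      exact hge ih
  have heq : ∀ k ≤ K, frozenProd F c k ω = ∏ ν ∈ Finset.Icc 1 k, F ν ω := by
    intro k
    induction k with
    | zero => intro _; simp [frozenProd]
    | succ k ih =>
      intro hk
      have h1 := hlt k (by omega)
      rw [Finset.prod_Icc_succ_top (by omega), ← ih (by omega)]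
      simp only [frozenProd, if_pos h1]
  exact fun k hk => heq k hk ▸ hlt k hk

/-- **Ville's inequality** for a product of bounded nonnegative factors with conditional
expectation at most one. -/
theorem ville_prod {Ω : Type*} {mΩ : MeasurableSpace Ω} (μ : Measure Ω) [IsProbabilityMeasure μ]
    (K : ℕ) (m : ℕ → MeasurableSpace Ω) (F : ℕ → Ω → ℝ) {D : ℝ} (hF : ∀ k ω, 0 ≤ F k ω)
    (hFD : ∀ k ω, F k ω ≤ D) (hFm : ∀ k ∈ Finset.Icc 1 K, Measurable (F k))
    (hadapted : ∀ k ∈ Finset.Icc 1 K, ∀ ν, 1 ≤ ν → ν < k → Measurable[m k] (F ν))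
    (hstep : ∀ k ∈ Finset.Icc 1 K, ∀ G : Ω → ℝ, Measurable[m k] G → (∀ ω, 0 ≤ G ω) →
      (∃ C, ∀ ω, G ω ≤ C) → ∫ ω, G ω * F k ω ∂μ ≤ ∫ ω, G ω ∂μ) {c : ℝ} (hc : 0 < c) :
    1 - 1 / c ≤ μ.real {ω | ∀ k ≤ K, ∏ ν ∈ Finset.Icc 1 k, F ν ω < c} := by
  have hmeas : ∀ k ≤ K, Measurable (frozenProd F c k) := fun k hk =>
    measurable_frozenProd c k fun ν hν => hFm ν (Finset.Icc_subset_Icc_right hk hν)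
  have hbdd : ∀ {G : Ω → ℝ}, Measurable G → (∀ ω, 0 ≤ G ω) → (∃ C, ∀ ω, G ω ≤ C) →
      Integrable G μ := by
    rintro G hG h0 ⟨C, hC⟩
    exact Integrable.of_bound hG.aestronglyMeasurable C (ae_of_all _ fun ω => by
      rw [Real.norm_of_nonneg (h0 ω)]; exact hC ω)
  have hint : ∀ k ≤ K, Integrable (frozenProd F c k) μ := fun k hk =>
    hbdd (hmeas k hk) (frozenProd_nonneg hF c k) (exists_frozenProd_le hF hFD c k)
  have hexp : ∀ k ≤ K, ∫ ω, frozenProd F c k ω ∂μ ≤ 1 := by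
    intro k
    induction k with
    | zero => intro _; simp [frozenProd]
    | succ k ih =>
      intro hk
      have hk1 : k + 1 ∈ Finset.Icc 1 K := Finset.mem_Icc.mpr ⟨by omega, hk⟩
      refine le_trans ?_ (ih (by omega))
      set N := frozenProd F c k with hN
      obtain ⟨C, hC⟩ := exists_frozenProd_le hF hFD c k
      -- G is the part still running, which gets multiplied by the next factor; R is the part
      -- already frozen, which is carried over unchanged.
      let G : Ω → ℝ := fun ω => if N ω < c then N ω else 0
      let R : Ω → ℝ := fun ω => if N ω < c then 0 else N ω
      have hNm : Measurable[m (k + 1)] N := measurable_frozenProd c k fun ν hν => by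
        obtain ⟨h1, h2⟩ := Finset.mem_Icc.mp hν
        exact hadapted (k + 1) hk1 ν h1 (by omega)
      have hG0 : ∀ ω, 0 ≤ G ω := fun ω => by
        simp only [G]; split_ifs
        exacts [frozenProd_nonneg hF c k ω, le_rfl]
      have hGC : ∀ ω, G ω ≤ C := fun ω => by
        simp only [G]; split_ifs
        exacts [hC ω, (frozenProd_nonneg hF c k ω).trans (hC ω)]
      have hGm : Measurable[m (k + 1)] G :=
        Measurable.ite (measurableSet_lt hNm measurable_const) hNm measurable_const
      have hNm' := hmeas k (by omega)
      have hGm' : Measurable G :=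
        Measurable.ite (measurableSet_lt hNm' measurable_const) hNm' measurable_const
      have hRm' : Measurable R :=
        Measurable.ite (measurableSet_lt hNm' measurable_const) measurable_const hNm'
      have hRi : Integrable R μ := hbdd hRm' (fun ω => by
        simp only [R]; split_ifs
        exacts [le_rfl, frozenProd_nonneg hF c k ω]) ⟨C, fun ω => by
        simp only [R]; split_ifs
        exacts [(frozenProd_nonneg hF c k ω).trans (hC ω), hC ω]⟩
      have hGFi : Integrable (fun ω => G ω * F (k + 1) ω) μ :=
        hbdd (hGm'.mul (hFm _ hk1)) (fun ω => mul_nonneg (hG0 ω) (hF _ _))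
          ⟨C * D, fun ω => mul_le_mul (hGC ω) (hFD _ _) (hF _ _) ((hG0 ω).trans (hGC ω))⟩
      have e1 : ∀ ω, frozenProd F c (k + 1) ω = G ω * F (k + 1) ω + R ω := fun ω => by
        simp only [frozenProd, G, R, ← hN]
        split_ifs <;> simp
      have e2 : ∀ ω, N ω = G ω + R ω := fun ω => by
        simp only [G, R]
        split_ifs <;> simp
      calc ∫ ω, frozenProd F c (k + 1) ω ∂μ = ∫ ω, G ω * F (k + 1) ω ∂μ + ∫ ω, R ω ∂μ := by
            simp only [e1]; exact integral_add hGFi hRi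
        _ ≤ ∫ ω, G ω ∂μ + ∫ ω, R ω ∂μ := by
            gcongr ?_ + _
            exact hstep (k + 1) hk1 G hGm hG0 ⟨C, hGC⟩
        _ = ∫ ω, N ω ∂μ := by
            simp only [e2]; exact (integral_add (hbdd hGm' hG0 ⟨C, hGC⟩) hRi).symm
  have hmarkov := mul_meas_ge_le_integral_of_nonneg (μ := μ)
    (ae_of_all _ (frozenProd_nonneg hF c K)) (hint K le_rfl) c
  have hbad : μ.real {ω | c ≤ frozenProd F c K ω} ≤ 1 / c := by
    rw [le_div_iff₀' hc]
    exact hmarkov.trans (hexp K le_rfl)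
  have hms : MeasurableSet {ω | c ≤ frozenProd F c K ω} :=
    measurableSet_le measurable_const (hmeas K le_rfl)
  calc 1 - 1 / c ≤ 1 - μ.real {ω | c ≤ frozenProd F c K ω} := by gcongr
    _ = μ.real {ω | c ≤ frozenProd F c K ω}ᶜ := (probReal_compl_eq_one_sub hms).symm
    _ ≤ _ := measureReal_mono fun ω hω => by
        simp only [Set.mem_compl_iff, Set.mem_ofPred_eq, not_le] at hω
        exact prod_lt_of_frozenProd_lt F c K ω hω

/-- If the conditional law of `X` given `m` is `p` and `∑ p f ≤ 1` with `m`-measurable `f`, then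
`f (X)` has conditional expectation at most one, tested against `m`-measurable functions. -/
theorem integral_mul_le_of_condExp_eq {Ω S : Type*} {m mΩ : MeasurableSpace Ω} [Fintype S]
    [MeasurableSpace S] [MeasurableSingletonClass S] (μ : Measure Ω) [IsProbabilityMeasure μ]
    (hm : m ≤ mΩ) {X : Ω → S} (hX : Measurable X) {p f : S → Ω → ℝ}
    (hp : ∀ t, μ[(X ⁻¹' {t}).indicator (fun _ => (1 : ℝ)) | m] =ᵐ[μ] p t)
    (hfm : ∀ t, Measurable[m] (f t)) (hf0 : ∀ t ω, 0 ≤ f t ω) {D : ℝ} (hfD : ∀ t ω, f t ω ≤ D)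
    (hpf : ∀ ω, ∑ t, p t ω * f t ω ≤ 1) {G : Ω → ℝ} (hGm : Measurable[m] G) (hG0 : ∀ ω, 0 ≤ G ω)
    (hGC : ∃ C, ∀ ω, G ω ≤ C) : ∫ ω, G ω * f (X ω) ω ∂μ ≤ ∫ ω, G ω ∂μ := by
  classical
  obtain ⟨C, hC⟩ := hGC
  have hGfC : ∀ t ω, ‖G ω * f t ω‖ ≤ C * D := fun t ω => by
    rw [Real.norm_of_nonneg (mul_nonneg (hG0 ω) (hf0 t ω))]
    exact mul_le_mul (hC ω) (hfD t ω) (hf0 t ω) ((hG0 ω).trans (hC ω))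
  have hI : ∀ t, Integrable ((X ⁻¹' {t}).indicator fun _ => (1 : ℝ)) μ := fun t =>
    (integrable_const 1).indicator (hX (measurableSet_singleton t))
  have hGi : Integrable G μ := Integrable.of_bound (hGm.mono hm le_rfl).aestronglyMeasurable C
    (ae_of_all _ fun ω => by rw [Real.norm_of_nonneg (hG0 ω)]; exact hC ω)
  have hterm : ∀ t, Integrable (fun ω => (G ω * f t ω) *
      (X ⁻¹' {t}).indicator (fun _ => (1 : ℝ)) ω) μ := fun t =>
    (hI t).bdd_mul ((hGm.mul (hfm t)).mono hm le_rfl).aestronglyMeasurable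
      (ae_of_all _ (hGfC t))
  have hpi : ∀ t, Integrable (p t) μ := fun t => integrable_condExp.congr (hp t)
  have hterm' : ∀ t, Integrable (fun ω => (G ω * f t ω) * p t ω) μ := fun t =>
    (hpi t).bdd_mul ((hGm.mul (hfm t)).mono hm le_rfl).aestronglyMeasurable
      (ae_of_all _ (hGfC t))
  -- For a fixed value t of X the factor G · f t is m-measurable and bounded, so it can be pulled
  -- out and the indicator replaced by its conditional probability.
  have hpull : ∀ t, ∫ ω, (G ω * f t ω) * (X ⁻¹' {t}).indicator (fun _ => (1 : ℝ)) ω ∂μ =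
      ∫ ω, (G ω * f t ω) * p t ω ∂μ := by
    intro t
    rw [← integral_condExp hm]
    refine integral_congr_ae ?_
    have h1 := condExp_stronglyMeasurable_mul_of_bound (μ := μ) hm
      (hGm.mul (hfm t)).stronglyMeasurable (hI t) (C * D) (ae_of_all _ (hGfC t))
    filter_upwards [h1, hp t] with ω h1 h2
    have h3 := h1
    simp only [Pi.mul_apply] at h3
    rw [← h2]
    exact h3
  have e : ∀ ω, G ω * f (X ω) ω =
      ∑ t, (G ω * f t ω) * (X ⁻¹' {t}).indicator (fun _ => (1 : ℝ)) ω := fun ω => by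
    simp [Set.indicator_apply]
  calc ∫ ω, G ω * f (X ω) ω ∂μ = ∑ t, ∫ ω, (G ω * f t ω) * p t ω ∂μ := by
        simp only [e]
        rw [integral_finsetSum _ fun t _ => hterm t]
        exact Finset.sum_congr rfl fun t _ => hpull t
    _ = ∫ ω, ∑ t, (G ω * f t ω) * p t ω ∂μ := (integral_finsetSum _ fun t _ => hterm' t).symm
    _ ≤ ∫ ω, G ω ∂μ := by
        refine integral_mono (integrable_finsetSum _ fun t _ => hterm' t) hGi fun ω => ?_
        calc ∑ t, (G ω * f t ω) * p t ω = G ω * ∑ t, p t ω * f t ω := by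
              rw [Finset.mul_sum]; exact Finset.sum_congr rfl fun t _ => by ring
          _ ≤ G ω := mul_le_of_le_one_right (hG0 ω) (hpf ω)

end Ville

/-! ### Concentration of the linearized regret. -/

/-- The linearized regret of round `ν`. -/
noncomputable def linRegret {S A Ω : Type*} [MeasurableSpace A] {d H : ℕ}
    (M : MNLModel S A d H) (s : ℕ → Fin (H + 1) → Ω → S)
    (a : ℕ → Fin H → Ω → A) (h : Fin H) (ε η B : ℝ) (ν : ℕ) (ω : Ω) : ℝ :=
  inner ℝ (onsGrad (realizedLoss M s a h ω) ε η B ν)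
    (onsIterate (realizedLoss M s a h ω) ε η B (ν - 1) - M.θstar h)

theorem onsGrad_realizedLoss {S A Ω : Type*} [MeasurableSpace A] {d H : ℕ}
    (M : MNLModel S A d H) (s : ℕ → Fin (H + 1) → Ω → S)
    (a : ℕ → Fin H → Ω → A) (h : Fin H) (ε η B : ℝ) (ν : ℕ) (ω : Ω) :
    onsGrad (realizedLoss M s a h ω) ε η B ν =
      M.nllGrad h (s ν h.castSucc ω) (a ν h ω) (s ν h.succ ω)
        (onsIterate (realizedLoss M s a h ω) ε η B (ν - 1)) := by
  rw [onsGrad, realizedLoss, MNLModel.gradient_nll]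

section Interaction

variable {S A Ω : Type*} [MeasurableSpace S] [MeasurableSpace A] {d H : ℕ}

theorem measurable_state_history (s : ℕ → Fin (H + 1) → Ω → S) (a : ℕ → Fin H → Ω → A) {j k : ℕ}
    (hj : 1 ≤ j) (hjk : j < k) (h : Fin H) (i : Fin (H + 1)) :
    Measurable[history s a k h] (s j i) := by
  rw [measurable_iff_comap_le]
  exact le_sup_of_le_left (le_sup_of_le_left (le_sup_of_le_left
    (le_iSup₂_of_le j ⟨hj, hjk⟩ (le_iSup_of_le i le_rfl))))

theorem measurable_action_history (s : ℕ → Fin (H + 1) → Ω → S) (a : ℕ → Fin H → Ω → A) {j k : ℕ}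
    (hj : 1 ≤ j) (hjk : j < k) (h i : Fin H) : Measurable[history s a k h] (a j i) := by
  rw [measurable_iff_comap_le]
  exact le_sup_of_le_left (le_sup_of_le_left (le_sup_of_le_right
    (le_iSup₂_of_le j ⟨hj, hjk⟩ (le_iSup_of_le i le_rfl))))

theorem measurable_current_state_history (s : ℕ → Fin (H + 1) → Ω → S) (a : ℕ → Fin H → Ω → A)
    (k : ℕ) (h : Fin H) : Measurable[history s a k h] (s k h.castSucc) := by
  rw [measurable_iff_comap_le]
  exact le_sup_of_le_left (le_sup_of_le_right (le_iSup₂_of_le h.castSucc le_rfl le_rfl))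

theorem measurable_current_action_history (s : ℕ → Fin (H + 1) → Ω → S) (a : ℕ → Fin H → Ω → A)
    (k : ℕ) (h : Fin H) : Measurable[history s a k h] (a k h) := by
  rw [measurable_iff_comap_le]
  exact le_sup_of_le_right (le_iSup₂_of_le h le_rfl le_rfl)

theorem IsInteraction.history_le [mΩ : MeasurableSpace Ω] {M : MNLModel S A d H} {μ : Measure Ω}
    {K : ℕ} {s : ℕ → Fin (H + 1) → Ω → S} {a : ℕ → Fin H → Ω → A} (hI : IsInteraction M μ K s a)
    {k : ℕ} (hk : k ∈ Finset.Icc 1 K) (h : Fin H) : history s a k h ≤ mΩ := by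
  have hmem : ∀ {j}, 1 ≤ j ∧ j < k → j ∈ Finset.Icc 1 K := fun hj =>
    Finset.mem_Icc.mpr ⟨hj.1, hj.2.le.trans (Finset.mem_Icc.mp hk).2⟩
  refine sup_le (sup_le (sup_le ?_ ?_) ?_) ?_
  · exact iSup_le fun j => iSup₂_le fun hj i =>
      measurable_iff_comap_le.mp (hI.measurable_state j (hmem hj) i)
  · exact iSup_le fun j => iSup₂_le fun hj i =>
      measurable_iff_comap_le.mp (hI.measurable_action j (hmem hj) i)
  · exact iSup₂_le fun i _ => measurable_iff_comap_le.mp (hI.measurable_state k hk i)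
  · exact iSup₂_le fun i _ => measurable_iff_comap_le.mp (hI.measurable_action k hk i)

variable [Fintype S] [MeasurableSingletonClass S]

theorem measurable_gradient_realizedLoss {m : MeasurableSpace Ω} (M : MNLModel S A d H)
    (s : ℕ → Fin (H + 1) → Ω → S) (a : ℕ → Fin H → Ω → A) (h : Fin H) {ν : ℕ}
    (hs : ∀ i, Measurable (s ν i)) (ha : Measurable (a ν h))
    {θ : Ω → EuclideanSpace ℝ (Fin d)} (hθ : Measurable θ) :
    Measurable fun ω => gradient (realizedLoss M s a h ω ν) (θ ω) := by
  simp only [realizedLoss, MNLModel.gradient_nll]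
  exact M.measurable_nllGrad h (hs _) ha (hs _) hθ

/-- With probability at least `1 - δ`, the sum of `2 η x - (3 / 2) x²` over the linearized regrets
`x` is never very negative. -/
theorem linRegret_concentration [mΩ : MeasurableSpace Ω] {μ : Measure Ω} [IsProbabilityMeasure μ]
    {K : ℕ} {M : MNLModel S A d H} {BΦ Bθ ε δ : ℝ} {s : ℕ → Fin (H + 1) → Ω → S}
    {a : ℕ → Fin H → Ω → A} (h : Fin H) (hB1 : 0 ≤ BΦ) (hB2 : 0 ≤ Bθ) (hε : 0 < ε) (hδ : 0 < δ)
    (hM : ∀ s₀ a₀ s₁, ‖M.feature s₀ a₀ s₁‖ ≤ BΦ) (hθ : ∀ i, ‖M.θstar i‖ ≤ Bθ)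
    (hI : IsInteraction M μ K s a) :
    1 - δ ≤ μ.real {ω | ∀ k ≤ K,
      -(1000 * max 1 (BΦ * Bθ) ^ 4 * Real.log (1 / δ)) ≤ ∑ ν ∈ Finset.Icc 1 k,
        (2 * learningRate BΦ Bθ * linRegret M s a h ε (learningRate BΦ Bθ) Bθ ν ω -
          3 / 2 * linRegret M s a h ε (learningRate BΦ Bθ) Bθ ν ω ^ 2)} := by
  set η := learningRate BΦ Bθ with hη
  set r := max 1 (BΦ * Bθ) with hr
  have hr1 : 1 ≤ r := le_max_left _ _
  set c := 1 / (1000 * r ^ 4) with hc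
  have hc0 : 0 < c := by positivity
  let θ : ℕ → Ω → EuclideanSpace ℝ (Fin d) := fun k ω => onsIterate (realizedLoss M s a h ω) ε η Bθ k
  have hθB : ∀ k ω, ‖θ k ω‖ ≤ Bθ := fun k ω => norm_onsIterate_le _ ε η hB2 k
  -- The next state is a free argument t: for fixed t everything is determined by the history, and
  -- randomness enters only when the realized state is substituted in `F`.
  let x : ℕ → S → Ω → ℝ := fun k t ω =>
    inner ℝ (M.nllGrad h (s k h.castSucc ω) (a k h ω) t (θ (k - 1) ω)) (θ (k - 1) ω - M.θstar h)
  let f : ℕ → S → Ω → ℝ := fun k t ω => Real.exp (-c * (2 * η * x k t ω - 3 / 2 * x k t ω ^ 2))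
  let F : ℕ → Ω → ℝ := fun k ω => f k (s k h.succ ω) ω
  have hxF : ∀ k ω, x k (s k h.succ ω) ω = linRegret M s a h ε η Bθ k ω := fun k ω => by
    rw [linRegret, onsGrad_realizedLoss]
  have hxb : ∀ k t ω, |x k t ω| ≤ 4 * r := fun k t ω => by
    have hv : ‖θ (k - 1) ω - M.θstar h‖ ≤ 2 * Bθ :=
      (norm_sub_le _ _).trans (by linarith [hθB (k - 1) ω, hθ h])
    calc |x k t ω| ≤ _ := abs_real_inner_le_norm _ _
      _ ≤ (2 * BΦ) * (2 * Bθ) := by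
        gcongr
        exact M.norm_nllGrad_le hM h _ _ t _
      _ = 4 * (BΦ * Bθ) := by ring
      _ ≤ 4 * r := by gcongr; exact le_max_right _ _
  have hη0 : 0 ≤ η := by
    have := learningRate_lower BΦ Bθ
    have hb : 0 ≤ BΦ * Bθ := mul_nonneg hB1 hB2
    linarith
  have hfb : ∀ k t ω, f k t ω ≤ Real.exp (c * (2 * η * (4 * r) + 3 / 2 * (4 * r) ^ 2)) := by
    intro k t ω
    refine Real.exp_le_exp.mpr ?_
    rw [neg_mul, ← mul_neg]
    refine mul_le_mul_of_nonneg_left ?_ hc0.le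
    have h1 := hxb k t ω
    have h2 : x k t ω ^ 2 ≤ (4 * r) ^ 2 := by
      rw [← sq_abs (x k t ω)]; gcongr
    have h3 := mul_le_mul_of_nonneg_left (neg_le_of_abs_le h1) hη0
    linarith
  -- The sigma-algebra is arbitrary because both the ambient one and the histories are needed. Since
  -- θ_{k-1} involves only episodes before k, it is predictable.
  have hθm : ∀ (m : MeasurableSpace Ω) (n : ℕ), (∀ ν ∈ Finset.Icc 1 n, (∀ i, Measurable (s ν i)) ∧
      Measurable (a ν h)) → ∀ k ≤ n, Measurable (θ k) := fun m n hn =>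
    measurable_onsIterate (fun ω => realizedLoss M s a h ω) hε η hB2 n fun ν hν θ' hθ' =>
      measurable_gradient_realizedLoss M s a h (hn ν hν).1 (hn ν hν).2 hθ'
  have hfm : ∀ (m : MeasurableSpace Ω) (k : ℕ) (X : Ω → S), Measurable (s k h.castSucc) →
      Measurable (a k h) → Measurable X → Measurable (θ (k - 1)) →
      Measurable fun ω => f k (X ω) ω := by
    intro m k X h1 h2 h3 h4
    have hx : Measurable fun ω => x k (X ω) ω :=
      (M.measurable_nllGrad h h1 h2 h3 h4).inner (h4.sub measurable_const)
    exact ((((hx.const_mul (2 * η)).sub ((hx.pow_const 2).const_mul (3 / 2))).const_mul (-c))).exp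
  have hville := ville_prod μ K (fun k => history s a k h) F
    (fun k ω => (Real.exp_pos _).le) (fun k ω => hfb k _ ω) ?_ ?_ ?_ (one_div_pos.mpr hδ)
  · rw [one_div_one_div] at hville
    refine hville.trans (measureReal_mono fun ω hω k hk => ?_)
    have h1 := hω k hk
    simp only [F, f, hxF] at h1
    rw [← Real.exp_sum, ← Real.lt_log_iff_exp_lt (one_div_pos.mpr hδ), ← Finset.mul_sum] at h1
    set Y := ∑ ν ∈ Finset.Icc 1 k, (2 * η * linRegret M s a h ε η Bθ ν ω -
      3 / 2 * linRegret M s a h ε η Bθ ν ω ^ 2)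
    have h2 := mul_lt_mul_of_pos_left h1 (by positivity : 0 < 1000 * r ^ 4)
    have h3 : 1000 * r ^ 4 * (-c * Y) = -Y := by rw [hc]; field_simp
    rw [h3] at h2
    linarith
  · intro k hk
    obtain ⟨hk1, hk2⟩ := Finset.mem_Icc.mp hk
    refine hfm mΩ k _ (hI.measurable_state k hk _) (hI.measurable_action k hk _)
      (hI.measurable_state k hk _) (hθm mΩ (k - 1) (fun ν hν => ?_) (k - 1) le_rfl)
    have hν' : ν ∈ Finset.Icc 1 K := by
      simp only [Finset.mem_Icc] at hν ⊢; omega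
    exact ⟨hI.measurable_state ν hν', hI.measurable_action ν hν' h⟩
  · intro k hk ν hν1 hνk
    refine hfm (history s a k h) ν _ (measurable_state_history s a hν1 hνk h _)
      (measurable_action_history s a hν1 hνk h _) (measurable_state_history s a hν1 hνk h _)
      (hθm (history s a k h) (ν - 1) (fun j hj => ?_) (ν - 1) le_rfl)
    obtain ⟨hj1, hj2⟩ := Finset.mem_Icc.mp hj
    exact ⟨measurable_state_history s a hj1 (by omega) h,
      measurable_action_history s a hj1 (by omega) h h⟩
  · intro k hk G hGm hG0 hGC
    refine integral_mul_le_of_condExp_eq μ (hI.history_le hk h) (hI.measurable_state k hk h.succ)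
      (p := fun t ω => M.transProb h (s k h.castSucc ω) (a k h ω) (M.θstar h) t) (f := f k)
      (fun t => hI.transition k hk h t) (fun t => ?_) (fun t ω => (Real.exp_pos _).le)
      (fun t ω => hfb k t ω) (fun ω => ?_) hGm hG0 hGC
    · refine hfm (history s a k h) k (fun _ => t) (measurable_current_state_history s a k h)
        (measurable_current_action_history s a k h) measurable_const
        (hθm (history s a k h) (k - 1) (fun j hj => ?_) (k - 1) le_rfl)
      obtain ⟨hj1, hj2⟩ := Finset.mem_Icc.mp hj
      exact ⟨measurable_state_history s a hj1 (by omega) h,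
        measurable_action_history s a hj1 (by omega) h h⟩
    · exact M.sum_transProb_mul_exp_le_one hB1 hB2 hM h _ _ (hθB (k - 1) ω) (hθ h)

end Interaction

/-! ### The confidence radius and the conclusion. -/

/-- The radius parameter of the confidence ellipsoid. -/
noncomputable def confRadius (d : ℕ) (BΦ Bθ ε δ : ℝ) (k : ℕ) : ℝ :=
  1000 * (ε * Bθ ^ 2 + d * (max 1 (BΦ * Bθ)) ^ 4 *
    (1 + Real.log (d * k / δ) + Real.log (1 + BΦ ^ 2 / ε)))

theorem log_div_nonneg {d k : ℕ} {δ : ℝ} (hd : 1 ≤ d) (hk : 1 ≤ k) (hδ : 0 < δ) (hδ1 : δ < 1) :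
    0 ≤ Real.log (d * k / δ) := by
  have hd' : (1 : ℝ) ≤ d := by exact_mod_cast hd
  have hk' : (1 : ℝ) ≤ k := by exact_mod_cast hk
  refine Real.log_nonneg ?_
  rw [le_div_iff₀ hδ]
  nlinarith

theorem confRadius_le_of_eq {d k : ℕ} {BΦ Bθ ε δ : ℝ} (hd : 1 ≤ d) (hk : 1 ≤ k) (hδ : 0 < δ)
    (hδ1 : δ < 1) (hε : 0 < ε) (hb : 1 ≤ BΦ * Bθ)
    (hεeq : ε = BΦ ^ 2 * (1 + 4 * Real.log (d / δ))) :
    confRadius d BΦ Bθ ε δ k ≤ 6000 * (d * BΦ ^ 4 * Bθ ^ 4 * (1 + Real.log (d * k / δ))) := by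
  have hd' : (1 : ℝ) ≤ d := by exact_mod_cast hd
  have hk' : (1 : ℝ) ≤ k := by exact_mod_cast hk
  have hL := log_div_nonneg hd hk hδ hδ1
  have hl0 : 0 ≤ Real.log (d / δ) := by simpa using log_div_nonneg hd le_rfl hδ hδ1
  have hlL : Real.log (d / δ) ≤ Real.log (d * k / δ) := by
    refine Real.log_le_log (by positivity) ?_
    gcongr
    nlinarith
  set L := Real.log (d * k / δ)
  set b := BΦ * Bθ with hbdef
  -- This choice of ε is at least B_Φ², so the last logarithm is bounded by a constant.
  have hlog : Real.log (1 + BΦ ^ 2 / ε) ≤ 1 := by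
    have h1 : BΦ ^ 2 / ε ≤ 1 := by
      rw [div_le_one hε, hεeq]
      nlinarith [sq_nonneg BΦ]
    have h2 : 0 ≤ BΦ ^ 2 / ε := by positivity
    linarith [Real.log_le_sub_one_of_pos (by linarith : 0 < 1 + BΦ ^ 2 / ε)]
  have hb4 : d * BΦ ^ 4 * Bθ ^ 4 * (1 + L) = d * b ^ 4 * (1 + L) := by rw [hbdef]; ring
  have hε2 : ε * Bθ ^ 2 = b ^ 2 * (1 + 4 * Real.log (d / δ)) := by rw [hεeq, hbdef]; ring
  rw [confRadius, max_eq_right hb, hb4, hε2]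
  have h1 : b ^ 2 ≤ b ^ 4 := pow_le_pow_right₀ hb (by norm_num)
  -- The regularization contributes 4 and the dimension term 2, whence 6000 = 1000 · (4 + 2).
  have h2 : b ^ 2 * (1 + 4 * Real.log (d / δ)) ≤ d * b ^ 4 * (4 * (1 + L)) := by
    calc b ^ 2 * (1 + 4 * Real.log (d / δ)) ≤ b ^ 4 * (4 * (1 + L)) := by
          gcongr
          linarith
      _ ≤ d * (b ^ 4 * (4 * (1 + L))) := le_mul_of_one_le_left (by positivity) hd'
      _ = _ := by ring
  have h3 : d * b ^ 4 * (1 + L + Real.log (1 + BΦ ^ 2 / ε)) ≤ d * b ^ 4 * (2 * (1 + L)) := by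
    gcongr
    linarith
  linarith

/-- The deterministic combination of the regret bound and the concentration inequality. -/
theorem sum_sq_le_confRadius {d k : ℕ} {BΦ Bθ ε δ X η V : ℝ} (hd : 1 ≤ d) (hk : 1 ≤ k)
    (hε : 0 < ε) (hδ : 0 < δ) (hδ1 : δ < 1) (hη : 0 ≤ η)
    (hη2 : η ≤ 12.5 * max 1 (BΦ * Bθ) ^ 2)
    (hconc : -(1000 * max 1 (BΦ * Bθ) ^ 4 * Real.log (1 / δ)) ≤ V - 3 / 2 * X)
    (hreg : V - X ≤ ε * Bθ ^ 2 + η ^ 2 * (d * Real.log (d + k * (2 * BΦ) ^ 2 / ε))) :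
    X ≤ ε * Bθ ^ 2 + 4 * confRadius d BΦ Bθ ε δ k := by
  have hd' : (1 : ℝ) ≤ d := by exact_mod_cast hd
  have hk' : (1 : ℝ) ≤ k := by exact_mod_cast hk
  have hL := log_div_nonneg hd hk hδ hδ1
  have hdk : (1 : ℝ) ≤ d * k := by nlinarith
  set L := Real.log (d * k / δ) with hLdef
  have hl2 : 0 ≤ Real.log (1 + BΦ ^ 2 / ε) :=
    Real.log_nonneg (by linarith [div_nonneg (sq_nonneg BΦ) hε.le])
  set L2 := Real.log (1 + BΦ ^ 2 / ε) with hL2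
  set m := max 1 (BΦ * Bθ)
  have hm1 : 1 ≤ m := le_max_left _ _
  have hL3 : Real.log (1 / δ) ≤ L := Real.log_le_log (by positivity) (by gcongr)
  have hL4 : Real.log (d * k) ≤ L := by
    refine Real.log_le_log (by positivity) ?_
    rw [le_div_iff₀ hδ]
    nlinarith
  have hlog4 : Real.log 4 ≤ 3 := by
    linarith [Real.log_le_sub_one_of_pos (by norm_num : (0 : ℝ) < 4)]
  have hBε : 0 ≤ BΦ ^ 2 / ε := by positivity
  have hlog : Real.log (d + k * (2 * BΦ) ^ 2 / ε) ≤ 3 + L + L2 := by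
    calc Real.log (d + k * (2 * BΦ) ^ 2 / ε) ≤ Real.log (4 * (d * k) * (1 + BΦ ^ 2 / ε)) := by
          refine Real.log_le_log (by positivity) ?_
          have h1 : k * (2 * BΦ) ^ 2 / ε = 4 * (k * (BΦ ^ 2 / ε)) := by ring
          have h2 : k * (BΦ ^ 2 / ε) ≤ d * k * (BΦ ^ 2 / ε) := by
            gcongr
            exact le_mul_of_one_le_left (by positivity) hd'
          have h3 : (d : ℝ) ≤ d * k := le_mul_of_one_le_right (by positivity) hk'
          rw [h1]
          linarith
      _ = Real.log 4 + Real.log (d * k) + L2 := by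
          rw [Real.log_mul (by positivity) (by positivity),
            Real.log_mul (by positivity) (by positivity)]
      _ ≤ _ := by linarith
  have hη4 : η ^ 2 ≤ 156.25 * m ^ 4 := by
    calc η ^ 2 ≤ (12.5 * m ^ 2) ^ 2 := by gcongr
      _ = _ := by ring
  have h1 : η ^ 2 * (d * Real.log (d + k * (2 * BΦ) ^ 2 / ε)) ≤
      156.25 * m ^ 4 * (d * (3 + L + L2)) := by
    calc _ ≤ η ^ 2 * (d * (3 + L + L2)) := by gcongr
      _ ≤ _ := by gcongr
  have h2 : 1000 * m ^ 4 * Real.log (1 / δ) ≤ 1000 * m ^ 4 * (d * L) := by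
    gcongr
    exact hL3.trans (le_mul_of_one_le_left hL hd')
  have hP : 0 ≤ m ^ 4 * d := by positivity
  have hPL : 0 ≤ m ^ 4 * d * L := by positivity
  have hPL2 : 0 ≤ m ^ 4 * d * L2 := by positivity
  have hεB : 0 ≤ ε * Bθ ^ 2 := by positivity
  -- Subtracting the hypotheses and doubling bounds X by 2εB_θ² + 312.5 m⁴ d (3 + L + L2) + 2000 m⁴
  -- d L, all coefficients being below 4 · 1000.
  rw [confRadius]
  linarith

theorem theorem3 :
    -- the radius sequence is a known function of `d`, `B_Φ`, `B_θ`, `ε`, `δ` and `k` only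
    ∃ γ : ℕ → ℝ → ℝ → ℝ → ℝ → ℕ → ℝ,
      -- its order of magnitude, with an absolute constant
      (∃ C : ℝ, 0 < C ∧
        ∀ (d k : ℕ) (BΦ Bθ ε δ : ℝ), 1 ≤ d → 1 ≤ k → 0 ≤ BΦ → 0 ≤ Bθ → 0 < ε → 0 < δ → δ < 1 →
          0 ≤ γ d BΦ Bθ ε δ k ∧
          γ d BΦ Bθ ε δ k ≤ C * (ε * Bθ ^ 2 + d * (max 1 (BΦ * Bθ)) ^ 4 *
            (1 + Real.log (d * k / δ) + Real.log (1 + BΦ ^ 2 / ε))) ∧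
          (1 ≤ BΦ * Bθ → ε = BΦ ^ 2 * (1 + 4 * Real.log (d / δ)) →
            γ d BΦ Bθ ε δ k ≤ C * (d * BΦ ^ 4 * Bθ ^ 4 * (1 + Real.log (d * k / δ))))) ∧
      -- the confidence ellipsoid
      ∀ (S A Ω : Type*) [Fintype S] [MeasurableSpace S] [MeasurableSingletonClass S]
        [MeasurableSpace A] [MeasurableSpace Ω] (μ : Measure Ω) [IsProbabilityMeasure μ]
        (d H K : ℕ) (M : MNLModel S A d H) (BΦ Bθ ε δ : ℝ)
        (s : ℕ → Fin (H + 1) → Ω → S) (a : ℕ → Fin H → Ω → A) (h : Fin H),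
        1 ≤ d → 0 ≤ BΦ → 0 ≤ Bθ → 0 < ε → 0 < δ → δ < 1 →
        (∀ s₀ a₀ s₁, ‖M.feature s₀ a₀ s₁‖ ≤ BΦ) →
        (∀ i, ‖M.θstar i‖ ≤ Bθ) →
        IsInteraction M μ K s a →
        1 - 3 * δ ≤ μ.real {ω | ∀ k ∈ Finset.Icc 1 K,
          matNorm (obsInfo (realizedLoss M s a h ω) ε (learningRate BΦ Bθ) Bθ k)
              (estimator (realizedLoss M s a h ω) ε (learningRate BΦ Bθ) Bθ k - M.θstar h)
            ≤ Real.sqrt ε * Bθ + Real.sqrt (ε * Bθ ^ 2 + 4 * γ d BΦ Bθ ε δ k)} := by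
  refine ⟨confRadius, ⟨6000, by norm_num, ?_⟩, ?_⟩
  · intro d k BΦ Bθ ε δ hd hk _ _ hε hδ hδ1
    have hL := log_div_nonneg hd hk hδ hδ1
    have hl2 : 0 ≤ Real.log (1 + BΦ ^ 2 / ε) :=
      Real.log_nonneg (by linarith [div_nonneg (sq_nonneg BΦ) hε.le])
    refine ⟨by rw [confRadius]; positivity, ?_, confRadius_le_of_eq hd hk hδ hδ1 hε⟩
    rw [confRadius]
    gcongr
    norm_num
  · intro S A Ω _ _ _ _ _ μ _ d H K M BΦ Bθ ε δ s a h hd hB1 hB2 hε hδ hδ1 hM hθ hI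
    have hconc := linRegret_concentration h hB1 hB2 hε hδ hM hθ hI
    -- Only one random event, of failure probability at most δ, is involved; the remaining 2δ is
    -- slack.
    refine (by linarith : 1 - 3 * δ ≤ 1 - δ).trans (hconc.trans (measureReal_mono ?_))
    intro ω hω k hk
    obtain ⟨hk1, hk2⟩ := Finset.mem_Icc.mp hk
    have hc := hω k hk2
    have hG : ∀ ν ∈ Finset.Icc 1 k,
        ‖onsGrad (realizedLoss M s a h ω) ε (learningRate BΦ Bθ) Bθ ν‖ ≤ 2 * BΦ := fun ν _ => by
      rw [onsGrad_realizedLoss]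
      exact M.norm_nllGrad_le hM h _ _ _ _
    have hr := ons_regret (realizedLoss M s a h ω) hε (learningRate BΦ Bθ) hB2 (hθ h) k hG
    refine (matNorm_estimator_sub_le (realizedLoss M s a h ω) hε (learningRate BΦ Bθ)
      (hθ h) k).trans ?_
    gcongr
    have hη : 0 ≤ learningRate BΦ Bθ := by
      linarith [learningRate_lower BΦ Bθ, mul_nonneg hB1 hB2]
    rw [Finset.sum_sub_distrib] at hr hc
    rw [← Finset.mul_sum (a := (3 / 2 : ℝ))] at hc
    exact sum_sq_le_confRadius hd hk1 hε hδ hδ1 hη (learningRate_upper hB1 hB2) hc hr
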